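/- Let $n\in\mathbb N$ and let $p_H:\mathbb R^n\to[0,\infty)$ be a probability density of the form $p_H(x)=\frac1Z e^{-V(x)}$, where $Z>0$ and $V\in C^2(\mathbb R^n)$ satisfies $\nabla^2V(x)\succeq 0$ for all $x\in\mathbb R^n$. Let $(X_t)_{t\ge 0}$ be the variance-preserving (VP) process, i.e. the solution of $$\mathrm dX_t=-\tfrac12X_t\,\mathrm dt+\mathrm dW_t,\qquad X_0\sim p_H,$$ with $W$ a standard $n$-dimensional Brownian motion independent of $X_0$. Then, for every $t>0$, $X_t$ has the continuous, everywhere positive density $$p_t(x)=\int_{\mathbb R^n}p_H(y)\,\frac{1}{(2\pi(1-e^{-t}))^{n/2}}\exp\Big(-\frac{\|x-e^{-t/2}y\|^2}{2(1-e^{-t})}\Big)\,\mathrm dy,$$ and its score $s_t(x)=\nabla_x\log p_t(x)$ is defined and differentiable on all of $\mathbb R^n$. With $L(t):=\frac{2}{1-e^{-t}}$ for $t>0$, the following hold, where $\|\nabla s_t(x)\|$ is the operator norm with respect to the Euclidean norm: (i) $\sup_{x\in\mathbb R^n}\|\nabla s_t(x)\|\le L(t)<\infty$ for all $t>0$; (ii)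 $\int_\delta^T(1+L(t))\,\mathrm dt<\infty$ for all $0<\delta<T<\infty$. -/

import Mathlib

open MeasureTheory ProbabilityTheory Set
open scoped NNReal ENNReal

/-- `p` is a probability density on `ℝⁿ` with respect to Lebesgue measure. -/
structure IsProbDensity {n : ℕ} (p : EuclideanSpace ℝ (Fin n) → ℝ) : Prop where
  nonneg : ∀ x, 0 ≤ p x
  integrable : Integrable p volume
  integral_eq_one : ∫ x, p x = 1

/-- The measure `p(x) dx` on `ℝⁿ`. -/
noncomputable def densityMeasure {n : ℕ} (p : EuclideanSpace ℝ (Fin n) → ℝ) :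
    Measure (EuclideanSpace ℝ (Fin n)) :=
  volume.withDensity fun x => ENNReal.ofReal (p x)

/-- The density of the Gaussian `N(μ, v Iₙ)` on `ℝⁿ` (for `v > 0`). -/
noncomputable def gaussianDensity {n : ℕ} (v : ℝ) (μ x : EuclideanSpace ℝ (Fin n)) : ℝ :=
  (2 * Real.pi * v) ^ (-(n : ℝ) / 2) * Real.exp (-‖x - μ‖ ^ 2 / (2 * v))

/-- `W` is a standard `n`-dimensional Brownian motion: its coordinates are independent real
Brownian motions (with almost surely continuous paths, started at `0`). -/
structure IsBrownianVec {n : ℕ} {Ω : Type*} [MeasurableSpace Ω]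
    (W : ℝ≥0 → Ω → EuclideanSpace ℝ (Fin n)) (P : Measure Ω) : Prop where
  coord : ∀ i : Fin n, IsBrownianReal (fun t ω => W t ω i) P
  indep : iIndepFun (fun (i : Fin n) (ω : Ω) (t : ℝ≥0) => W t ω i) P

/-- `X` solves the variance-preserving SDE `dX_t = -½ X_t dt + dW_t` with `X_0 ~ p_H`
independent of the standard Brownian motion `W`. The noise is additive, so the SDE is the
pathwise integral equation `X_t = X_0 - ½ ∫₀ᵗ X_s ds + W_t`. -/
structure IsVPProcess {n : ℕ} {Ω : Type*} [MeasurableSpace Ω]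
    (pH : EuclideanSpace ℝ (Fin n) → ℝ)
    (X W : ℝ≥0 → Ω → EuclideanSpace ℝ (Fin n)) (P : Measure Ω) : Prop where
  brownian : IsBrownianVec W P
  aemeasurable : ∀ t, AEMeasurable (X t) P
  init : HasLaw (X 0) (densityMeasure pH) P
  indep : IndepFun (X 0) (fun ω t => W t ω) P
  continuous_paths : ∀ᵐ ω ∂P, Continuous fun t => X t ω
  sde : ∀ᵐ ω ∂P, ∀ t : ℝ≥0,
    X t ω = X 0 ω - (1 / 2 : ℝ) • (∫ s in (0 : ℝ)..t, X s.toNNReal ω) + W t ω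

/-- The marginal density of the VP process at time `t > 0`:
`p_t(x) = ∫ p_H(y) φ_{σ²(t),0}(x - a(t) y) dy` with `a(t) = e^{-t/2}`, `σ²(t) = 1 - e^{-t}`. -/
noncomputable def vpDensity {n : ℕ} (pH : EuclideanSpace ℝ (Fin n) → ℝ) (t : ℝ)
    (x : EuclideanSpace ℝ (Fin n)) : ℝ :=
  ∫ y, pH y * gaussianDensity (1 - Real.exp (-t)) 0 (x - Real.exp (-t / 2) • y)

/-- The score `s_t(x) = ∇ₓ log p_t(x)` of the VP process. -/
noncomputable def vpScore {n : ℕ} (pH : EuclideanSpace ℝ (Fin n) → ℝ) (t : ℝ)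
    (x : EuclideanSpace ℝ (Fin n)) : EuclideanSpace ℝ (Fin n) :=
  gradient (fun z => Real.log (vpDensity pH t z)) x

/-! With `v = 1 - e⁻ᵗ`, the Hessian of `log p_t` lies between `-(1/v) I` and `0`, so its operator
norm is at most `1/v`, half of `L(t)`.

Upper bound: `p_H` is log-concave because `V` is convex, and so is the Gaussian kernel; hence `(x,
y) ↦ p_H(y) φ_v(x - a y)` is jointly log-concave. Integrating out `y` preserves this by the
Prékopa–Leindler inequality, which is proved here for midpoints: Brunn–Minkowski on the line, then
the layer-cake formula, then induction on the dimension
(`EuclideanSpace.lintegral_mul_lintegral_le_sq`, `vpDensity_add_mul_sub_le_sq`).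

Lower bound: `e^{‖x‖²/(2v)} φ_v(x - a y)` is the exponential of an affine function of `x`, and a
mixture of log-convex functions is log-convex by Cauchy–Schwarz. So `log p_t + ‖x‖²/(2v)` is
midpoint convex (`vpDensity_sq_mul_exp_le`).

Both bounds are inequalities for second differences; as the score is differentiable they pass to the
quadratic form of its derivative, and symmetry turns that into an operator norm bound
(`norm_fderiv_vpScore_le`).

The law of `X_t` is identified by characteristic functions. The Euler scheme converges path by path
to `X_t`, and each Euler approximation is a multiple of `X_0` plus an independent Gaussian sum of
Brownian increments, so no stochastic integral is needed (`IsVPProcess.charFun_map`). -/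

/-! ### The Prékopa–Leindler inequality for midpoints -/

/-- One-dimensional Brunn–Minkowski inequality for nonempty compact sets and midpoints. -/
lemma volume_add_volume_le_of_midpoints_of_isCompact {K L S : Set ℝ} (hK : IsCompact K)
    (hL : IsCompact L) (hK0 : K.Nonempty) (hL0 : L.Nonempty)
    (hS : ∀ x ∈ K, ∀ y ∈ L, (x + y) / 2 ∈ S) :
    volume K + volume L ≤ 2 * volume S := by
  set k := sSup K with hk
  set l := sInf L with hl
  have hkK : k ∈ K := hK.sSup_mem hK0
  have hlL : l ∈ L := hL.sInf_mem hL0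
  -- The translates `K + min L` and `L + max K` both lie in `2S` and meet at most in the point `k +
  -- l`, so their measures add.
  set A : Set ℝ := (fun x => x + l) '' K
  set B : Set ℝ := (fun x => x + k) '' L
  have hAc : IsCompact A := hK.image (by fun_prop)
  have hBc : IsCompact B := hL.image (by fun_prop)
  have hA : volume A = volume K := by
    have : A = (fun x => x + -l) ⁻¹' K := by
      ext z; simp [A]
    rw [this, measure_preimage_add_right]
  have hB : volume B = volume L := by
    have : B = (fun x => x + -k) ⁻¹' L := by
      ext z; simp [B]
    rw [this, measure_preimage_add_right]
  have hAB : AEDisjoint volume A B := by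
    refine measure_mono_null (t := {k + l}) ?_ (by simp)
    rintro z ⟨⟨x, hx, rfl⟩, ⟨y, hy, hxy⟩⟩
    have h1 : x ≤ k := le_csSup hK.bddAbove hx
    have h2 : l ≤ y := csInf_le hL.bddBelow hy
    simp only [mem_singleton_iff] at *
    linarith
  have hU : A ∪ B ⊆ (fun x => (2⁻¹ : ℝ) * x) ⁻¹' S := by
    rintro z (⟨x, hx, rfl⟩ | ⟨y, hy, rfl⟩)
    · have := hS x hx l hlL
      simp only [mem_preimage]
      convert this using 1
      ring
    · have := hS k hkK y hy
      simp only [mem_preimage]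
      convert this using 1
      ring
  calc volume K + volume L = volume (A ∪ B) := by
        rw [measure_union₀ hBc.measurableSet.nullMeasurableSet hAB, hA, hB]
    _ ≤ volume ((fun x => (2⁻¹ : ℝ) * x) ⁻¹' S) := measure_mono hU
    _ = 2 * volume S := by
        rw [Real.volume_preimage_mul_left (by norm_num)]
        norm_num

/-- One-dimensional Brunn–Minkowski inequality for nonempty measurable sets and midpoints. -/
lemma volume_add_volume_le_of_midpoints {A B S : Set ℝ} (hA : MeasurableSet A)
    (hB : MeasurableSet B) (hA0 : A.Nonempty) (hB0 : B.Nonempty)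
    (hS : ∀ x ∈ A, ∀ y ∈ B, (x + y) / 2 ∈ S) :
    volume A + volume B ≤ 2 * volume S := by
  obtain ⟨a, ha⟩ := hA0
  obtain ⟨b, hb⟩ := hB0
  have key : ∀ K ⊆ A, IsCompact K → ∀ L ⊆ B, IsCompact L →
      volume K + volume L ≤ 2 * volume S := by
    intro K hKA hK L hLB hL
    -- The points `a` and `b` keep the compact sets nonempty, so that `key` also covers `∅`.
    refine le_trans (add_le_add (measure_mono (subset_insert a K))
      (measure_mono (subset_insert b L))) ?_
    refine volume_add_volume_le_of_midpoints_of_isCompact (hK.insert a) (hL.insert b)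
      (insert_nonempty _ _) (insert_nonempty _ _) fun x hx y hy => hS x ?_ y ?_
    · exact insert_subset ha hKA hx
    · exact insert_subset hb hLB hy
  refine ENNReal.le_of_forall_pos_le_add fun ε hε _ => ?_
  have hε' : (ε / 2 : ℝ≥0∞) ≠ 0 := by simpa using hε.ne'
  by_cases h1 : volume A = ∞
  · have : (∞ : ℝ≥0∞) ≤ 2 * volume S := by
      refine le_of_forall_lt fun c hc => ?_
      obtain ⟨K, hKA, hK, hcK⟩ := hA.exists_lt_isCompact (h1 ▸ hc)
      exact hcK.trans_le (le_trans le_self_add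
        (key K hKA hK ∅ (empty_subset _) isCompact_empty))
    rw [top_le_iff.1 this]
    simp
  by_cases h2 : volume B = ∞
  · have : (∞ : ℝ≥0∞) ≤ 2 * volume S := by
      refine le_of_forall_lt fun c hc => ?_
      obtain ⟨K, hKA, hK, hcK⟩ := hB.exists_lt_isCompact (h2 ▸ hc)
      exact hcK.trans_le (le_trans le_add_self
        (key ∅ (empty_subset _) isCompact_empty K hKA hK))
    rw [top_le_iff.1 this]
    simp
  obtain ⟨K, hKA, hK, hK'⟩ := hA.exists_isCompact_lt_add h1 hε'
  obtain ⟨L, hLB, hL, hL'⟩ := hB.exists_isCompact_lt_add h2 hε'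
  calc volume A + volume B ≤ (volume K + ε / 2) + (volume L + ε / 2) :=
        add_le_add hK'.le hL'.le
    _ = (volume K + volume L) + ε := by
        rw [add_add_add_comm, ENNReal.add_halves]
    _ ≤ 2 * volume S + ε := by gcongr; exact key K hKA hK L hLB hL

/-- Layer-cake formula plus Brunn–Minkowski for the superlevel sets. Brunn–Minkowski needs nonempty
sets: normalising both suprema to `1` makes the level sets of `f` and `g` nonempty for `t < 1` and
both empty for `t ≥ 1`. -/
lemma lintegral_add_lintegral_le_of_midpoints {f g h : ℝ → ℝ} (hf : Measurable f)
    (hg : Measurable g) (hh : Measurable h) (hf0 : ∀ x, 0 ≤ f x) (hg0 : ∀ x, 0 ≤ g x)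
    (hh0 : ∀ x, 0 ≤ h x) (hf1 : ∀ x, f x ≤ 1) (hg1 : ∀ x, g x ≤ 1)
    (hfs : ∀ t < 1, ∃ x, t < f x) (hgs : ∀ t < 1, ∃ x, t < g x)
    (H : ∀ x y, f x * g y ≤ h ((x + y) / 2) ^ 2) :
    (∫⁻ x, ENNReal.ofReal (f x)) + ∫⁻ x, ENNReal.ofReal (g x)
      ≤ 2 * ∫⁻ x, ENNReal.ofReal (h x) := by
  have hm : ∀ u : ℝ → ℝ, Measurable fun t : ℝ => volume {a | t < u a} := by
    intro u
    refine Antitone.measurable fun s t hst => measure_mono fun a ha => ?_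
    exact lt_of_le_of_lt hst ha
  rw [lintegral_eq_lintegral_meas_lt volume (.of_forall hf0) hf.aemeasurable,
    lintegral_eq_lintegral_meas_lt volume (.of_forall hg0) hg.aemeasurable,
    lintegral_eq_lintegral_meas_lt volume (.of_forall hh0) hh.aemeasurable,
    ← lintegral_add_left (hm f), ← lintegral_const_mul _ (hm h)]
  refine setLIntegral_mono ((hm h).const_mul _) fun t ht => ?_
  rcases lt_or_ge t 1 with h1 | h1
  · refine volume_add_volume_le_of_midpoints (measurableSet_lt measurable_const hf)
      (measurableSet_lt measurable_const hg) (hfs t h1) (hgs t h1) fun x hx y hy => ?_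
    have hx' : t < f x := hx
    have hy' : t < g y := hy
    have ht' : (0 : ℝ) < t := ht
    have h2 : t ^ 2 < h ((x + y) / 2) ^ 2 := by
      refine lt_of_lt_of_le ?_ (H x y)
      nlinarith
    exact lt_of_pow_lt_pow_left₀ 2 (hh0 _) h2
  · have e1 : {a | t < f a} = ∅ := by
      ext a; simpa using (hf1 a).trans h1
    have e2 : {a | t < g a} = ∅ := by
      ext a; simpa using (hg1 a).trans h1
    simp [e1, e2]

lemma ENNReal.four_mul_mul_le_add_sq (a b : ℝ≥0∞) : 4 * (a * b) ≤ (a + b) ^ 2 := by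
  by_cases ha : a = ∞
  · simp [ha]
  by_cases hb : b = ∞
  · simp [hb]
  lift a to ℝ≥0 using ha
  lift b to ℝ≥0 using hb
  norm_cast
  rw [← NNReal.coe_le_coe]
  push_cast
  nlinarith [sq_nonneg ((a : ℝ) - b)]

/-- Prékopa–Leindler inequality for midpoints on the line, for bounded functions. -/
lemma lintegral_mul_lintegral_le_sq_of_bounded {f g h : ℝ → ℝ} (hf : Measurable f)
    (hg : Measurable g) (hh : Measurable h) (hf0 : ∀ x, 0 ≤ f x) (hg0 : ∀ x, 0 ≤ g x)
    (hh0 : ∀ x, 0 ≤ h x) {N : ℝ} (hfN : ∀ x, f x ≤ N) (hgN : ∀ x, g x ≤ N)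
    (H : ∀ x y, f x * g y ≤ h ((x + y) / 2) ^ 2) :
    (∫⁻ x, ENNReal.ofReal (f x)) * ∫⁻ x, ENNReal.ofReal (g x)
      ≤ (∫⁻ x, ENNReal.ofReal (h x)) ^ 2 := by
  have bf : BddAbove (range f) := ⟨N, by rintro _ ⟨x, rfl⟩; exact hfN x⟩
  have bg : BddAbove (range g) := ⟨N, by rintro _ ⟨x, rfl⟩; exact hgN x⟩
  set F := ⨆ x, f x with hF
  set G := ⨆ x, g x with hG
  have hfF : ∀ x, f x ≤ F := fun x => le_ciSup bf x
  have hgG : ∀ x, g x ≤ G := fun x => le_ciSup bg x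
  rcases ((hf0 0).trans (hfF 0)).eq_or_lt with hF0 | hF0
  · have : ∀ x, f x = 0 := fun x => le_antisymm (hF0 ▸ hfF x) (hf0 x)
    simp [this]
  rcases ((hg0 0).trans (hgG 0)).eq_or_lt with hG0 | hG0
  · have : ∀ x, g x = 0 := fun x => le_antisymm (hG0 ▸ hgG x) (hg0 x)
    simp [this]
  have hFG : 0 < √(F * G) := by positivity
  -- Dividing `f`, `g`, `h` by `F`, `G`, `√(FG)` preserves `H`. The additive bound then becomes
  -- multiplicative through `4ab ≤ (a + b)²`, and the normalising constants cancel.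
  have key := lintegral_add_lintegral_le_of_midpoints (f := fun x => F⁻¹ * f x)
    (g := fun x => G⁻¹ * g x) (h := fun x => (√(F * G))⁻¹ * h x) (by fun_prop) (by fun_prop)
    (by fun_prop) (fun x => mul_nonneg (by positivity) (hf0 x))
    (fun x => mul_nonneg (by positivity) (hg0 x))
    (fun x => mul_nonneg (by positivity) (hh0 x))
    (fun x => by rw [inv_mul_le_one₀ hF0]; exact hfF x)
    (fun x => by rw [inv_mul_le_one₀ hG0]; exact hgG x)
    (fun t ht => by
      obtain ⟨x, hx⟩ := exists_lt_of_lt_ciSup (show t * F < F by nlinarith)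
      exact ⟨x, by rw [lt_inv_mul_iff₀ hF0]; linarith⟩)
    (fun t ht => by
      obtain ⟨x, hx⟩ := exists_lt_of_lt_ciSup (show t * G < G by nlinarith)
      exact ⟨x, by rw [lt_inv_mul_iff₀ hG0]; linarith⟩)
    (fun x y => by
      rw [mul_pow, inv_pow, Real.sq_sqrt (by positivity), mul_inv]
      have := mul_le_mul_of_nonneg_left (H x y) (show 0 ≤ F⁻¹ * G⁻¹ by positivity)
      linarith)
  simp only [ENNReal.ofReal_mul (inv_nonneg.2 hF0.le), ENNReal.ofReal_mul (inv_nonneg.2 hG0.le),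
    ENNReal.ofReal_mul (inv_nonneg.2 hFG.le)] at key
  rw [lintegral_const_mul _ (by fun_prop), lintegral_const_mul _ (by fun_prop),
    lintegral_const_mul _ (by fun_prop)] at key
  set A := ∫⁻ x, ENNReal.ofReal (f x)
  set B := ∫⁻ x, ENNReal.ofReal (g x)
  set C := ∫⁻ x, ENNReal.ofReal (h x)
  set k := ENNReal.ofReal (F⁻¹ * G⁻¹) with hk
  have hk1 : ENNReal.ofReal F⁻¹ * ENNReal.ofReal G⁻¹ = k := by
    rw [hk, ENNReal.ofReal_mul (by positivity)]
  have hk2 : ENNReal.ofReal (√(F * G))⁻¹ ^ 2 = k := by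
    rw [hk, ← ENNReal.ofReal_pow (by positivity), inv_pow, Real.sq_sqrt (by positivity), mul_inv]
  have hk0 : 4 * k ≠ 0 := by
    have : 0 < F⁻¹ * G⁻¹ := by positivity
    simpa [hk] using this
  have hkt : 4 * k ≠ ∞ := ENNReal.mul_ne_top (by norm_num) ENNReal.ofReal_ne_top
  have h2 : 4 * k * (A * B) ≤ 4 * k * C ^ 2 := by
    calc 4 * k * (A * B) = 4 * ((ENNReal.ofReal F⁻¹ * A) * (ENNReal.ofReal G⁻¹ * B)) := by
          rw [← hk1]; ring
      _ ≤ (ENNReal.ofReal F⁻¹ * A + ENNReal.ofReal G⁻¹ * B) ^ 2 :=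
          ENNReal.four_mul_mul_le_add_sq _ _
      _ ≤ (2 * (ENNReal.ofReal (√(F * G))⁻¹ * C)) ^ 2 := by gcongr
      _ = 4 * k * C ^ 2 := by rw [← hk2]; ring
  exact (ENNReal.mul_le_mul_iff_right hk0 hkt).1 h2

/-- Prékopa–Leindler inequality for midpoints on the line. -/
lemma lintegral_mul_lintegral_le_sq {f g h : ℝ → ℝ≥0∞} (hf : Measurable f)
    (hg : Measurable g) (hh : Measurable h)
    (H : ∀ x y, f x * g y ≤ h ((x + y) / 2) ^ 2) :
    (∫⁻ x, f x) * ∫⁻ x, g x ≤ (∫⁻ x, h x) ^ 2 := by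
  have hmin : ∀ (a : ℝ≥0∞) (N : ℕ), min a N ≠ ∞ := fun a N =>
    ne_top_of_le_ne_top (ENNReal.natCast_ne_top N) (min_le_right _ _)
  -- Truncating all three functions at the same height preserves `H`; monotone convergence removes
  -- the truncation.
  have htrunc : ∀ N : ℕ,
      (∫⁻ x, min (f x) N) * ∫⁻ x, min (g x) N ≤ (∫⁻ x, h x) ^ 2 := by
    intro N
    have := lintegral_mul_lintegral_le_sq_of_bounded (f := fun x => (min (f x) N).toReal)
      (g := fun x => (min (g x) N).toReal) (h := fun x => (min (h x) N).toReal)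
      (by fun_prop) (by fun_prop) (by fun_prop) (fun _ => ENNReal.toReal_nonneg)
      (fun _ => ENNReal.toReal_nonneg) (fun _ => ENNReal.toReal_nonneg) (N := N)
      (fun x => ENNReal.toReal_le_of_le_ofReal (by positivity) (by simp))
      (fun x => ENNReal.toReal_le_of_le_ofReal (by positivity) (by simp))
      (fun x y => by
        rw [← ENNReal.toReal_mul, ← ENNReal.toReal_pow]
        refine ENNReal.toReal_mono (ENNReal.pow_ne_top (hmin _ _)) ?_
        rcases le_total (h ((x + y) / 2)) N with h1 | h1
        · rw [min_eq_left h1]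
          exact le_trans (mul_le_mul' (min_le_left _ _) (min_le_left _ _)) (H x y)
        · rw [min_eq_right h1, sq]
          exact mul_le_mul' (min_le_right _ _) (min_le_right _ _))
    simp only [ENNReal.ofReal_toReal (hmin _ _)] at this
    refine this.trans ?_
    gcongr
    exact min_le_left _ _
  have hsup : ∀ u : ℝ → ℝ≥0∞, Measurable u → ∫⁻ x, u x = ⨆ N : ℕ, ∫⁻ x, min (u x) N := by
    intro u hu
    rw [← lintegral_iSup (fun N => hu.min measurable_const)
      (fun N M hNM x => min_le_min le_rfl (by exact_mod_cast hNM))]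
    congr 1 with x
    rw [← inf_iSup_eq, ENNReal.iSup_natCast, inf_top_eq]
  have hmono : ∀ u : ℝ → ℝ≥0∞, Monotone fun N : ℕ => ∫⁻ x, min (u x) N := fun u N M hNM =>
    lintegral_mono fun x => min_le_min le_rfl (by exact_mod_cast hNM)
  rw [hsup f hf, hsup g hg, ENNReal.iSup_mul, iSup_le_iff]
  intro N
  rw [ENNReal.mul_iSup, iSup_le_iff]
  intro M
  exact (mul_le_mul' (hmono f (le_max_left N M)) (hmono g (le_max_right N M))).trans (htrunc _)

/-- Prékopa–Leindler inequality for midpoints on `Fin n → ℝ`. -/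
theorem lintegral_mul_lintegral_le_sq_pi : ∀ {n : ℕ} {f g h : (Fin n → ℝ) → ℝ≥0∞},
    Measurable f → Measurable g → Measurable h →
    (∀ x y, f x * g y ≤ h ((2⁻¹ : ℝ) • (x + y)) ^ 2) →
    (∫⁻ x, f x) * ∫⁻ x, g x ≤ (∫⁻ x, h x) ^ 2
  | 0, f, g, h, _, _, _, H => by
    rw [volume_pi, Measure.pi_of_empty _ (0 : Fin 0 → ℝ)]
    simp only [lintegral_dirac]
    simpa using H 0 0
  | n + 1, f, g, h, hf, hg, hh, H => by
    let e := (MeasurableEquiv.piFinSuccAbove (fun _ : Fin (n + 1) => ℝ) 0).symm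
    have he : MeasurePreserving e :=
      (volume_preserving_piFinSuccAbove (fun _ : Fin (n + 1) => ℝ) 0).symm
    have hadd : ∀ p q : ℝ × (Fin n → ℝ),
        (2⁻¹ : ℝ) • (e p + e q) = e ((p.1 + q.1) / 2, (2⁻¹ : ℝ) • (p.2 + q.2)) := by
      intro p q
      ext i
      refine Fin.cases ?_ (fun j => ?_) i
      · simp [e, MeasurableEquiv.piFinSuccAbove, Fin.insertNthEquiv]; ring
      · simp [e, MeasurableEquiv.piFinSuccAbove, Fin.insertNthEquiv]; ring
    have hfub : ∀ u : (Fin (n + 1) → ℝ) → ℝ≥0∞, Measurable u →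
        ∫⁻ x, u x = ∫⁻ s : ℝ, ∫⁻ z : Fin n → ℝ, u (e (s, z)) := by
      intro u hu
      rw [← he.lintegral_comp hu, Measure.volume_eq_prod,
        lintegral_prod (f := fun p => u (e p)) (hu.comp e.measurable).aemeasurable]
    have hmeas : ∀ u : (Fin (n + 1) → ℝ) → ℝ≥0∞, Measurable u →
        Measurable fun s : ℝ => ∫⁻ z : Fin n → ℝ, u (e (s, z)) := fun u hu =>
      Measurable.lintegral_prod_right' (f := fun p => u (e p)) (hu.comp e.measurable)
    have hsec : ∀ (u : (Fin (n + 1) → ℝ) → ℝ≥0∞) (s : ℝ), Measurable u →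
        Measurable fun z : Fin n → ℝ => u (e (s, z)) := fun u s hu =>
      hu.comp (e.measurable.comp measurable_prodMk_left)
    rw [hfub f hf, hfub g hg, hfub h hh]
    -- The integrals over the slices satisfy the one-dimensional hypothesis precisely by the
    -- inequality in dimension `n`.
    refine lintegral_mul_lintegral_le_sq (hmeas f hf) (hmeas g hg) (hmeas h hh) fun s t => ?_
    refine lintegral_mul_lintegral_le_sq_pi (hsec f _ hf) (hsec g _ hg) (hsec h _ hh)
      fun x y => ?_
    have := H (e (s, x)) (e (t, y))
    rwa [hadd] at this

/-- Prékopa–Leindler inequality for midpoints on Euclidean space. -/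
theorem EuclideanSpace.lintegral_mul_lintegral_le_sq {n : ℕ}
    {f g h : EuclideanSpace ℝ (Fin n) → ℝ≥0∞}
    (hf : Measurable f) (hg : Measurable g) (hh : Measurable h)
    (H : ∀ x y, f x * g y ≤ h ((2⁻¹ : ℝ) • (x + y)) ^ 2) :
    (∫⁻ x, f x) * ∫⁻ x, g x ≤ (∫⁻ x, h x) ^ 2 := by
  have he := PiLp.volume_preserving_toLp (Fin n)
  rw [← he.lintegral_comp hf, ← he.lintegral_comp hg, ← he.lintegral_comp hh]
  refine lintegral_mul_lintegral_le_sq_pi (hf.comp he.measurable) (hg.comp he.measurable)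
    (hh.comp he.measurable) fun x y => ?_
  simpa using H (WithLp.toLp 2 x) (WithLp.toLp 2 y)

/-! ### Smoothness of the marginal density and of the score -/

/-- Differentiation of `x ↦ ∫ w(y) g(x - a y) dy` under the integral sign, for integrable `w` and
`g` bounded with bounded continuous derivative. -/
lemma hasFDerivAt_integral_smul_comp_sub {E F : Type*} [NormedAddCommGroup E] [NormedSpace ℝ E]
    [MeasurableSpace E] [BorelSpace E] [SecondCountableTopology E] {μ : Measure E}
    [NormedAddCommGroup F] [NormedSpace ℝ F] [SecondCountableTopology F]
    [SecondCountableTopology (E →L[ℝ] F)]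
    {w : E → ℝ} (hw : Integrable w μ) {g : E → F} {g' : E → E →L[ℝ] F}
    (hg : ∀ z, HasFDerivAt g (g' z) z) (hg' : Continuous g') {B C : ℝ}
    (hB : ∀ z, ‖g z‖ ≤ B) (hC : ∀ z, ‖g' z‖ ≤ C) (a : ℝ) (x : E) :
    HasFDerivAt (fun x => ∫ y, w y • g (x - a • y) ∂μ) (∫ y, w y • g' (x - a • y) ∂μ) x := by
  have hgc : Continuous g := continuous_iff_continuousAt.2 fun z => (hg z).continuousAt
  have m1 : ∀ x, AEStronglyMeasurable (fun y => w y • g (x - a • y)) μ := fun x =>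
    hw.aestronglyMeasurable.smul
      (Continuous.aestronglyMeasurable (by fun_prop))
  refine hasFDerivAt_integral_of_dominated_of_fderiv_le (s := univ)
    (F := fun x y => w y • g (x - a • y))
    (F' := fun x y => w y • g' (x - a • y)) (bound := fun y => ‖w y‖ * C) Filter.univ_mem
    (.of_forall m1) ?_ ?_ ?_ (hw.norm.mul_const C) ?_
  · refine (hw.norm.mul_const B).mono' (m1 x) (.of_forall fun y => ?_)
    rw [norm_smul]
    exact mul_le_mul_of_nonneg_left (hB _) (norm_nonneg _)
  · exact hw.aestronglyMeasurable.smul (Continuous.aestronglyMeasurable (by fun_prop))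
  · refine .of_forall fun y z _ => ?_
    rw [norm_smul]
    exact mul_le_mul_of_nonneg_left (hC _) (norm_nonneg _)
  · refine .of_forall fun y z _ => ?_
    have h1 : HasFDerivAt (fun x : E => x - a • y) (ContinuousLinearMap.id ℝ E) z :=
      (hasFDerivAt_id z).sub_const _
    have h2 := ((hg (z - a • y)).comp z h1).const_smul (w y)
    rw [ContinuousLinearMap.comp_id] at h2
    exact h2

section Gaussian

variable {n : ℕ} {v : ℝ}

lemma gaussianDensity_zero_pos (hv : 0 < v) (z : EuclideanSpace ℝ (Fin n)) :
    0 < gaussianDensity v 0 z := by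
  unfold gaussianDensity
  positivity

lemma continuous_gaussianDensity_zero :
    Continuous (gaussianDensity (n := n) v 0) := by
  unfold gaussianDensity
  fun_prop

lemma gaussianDensity_zero_le (hv : 0 < v) (z : EuclideanSpace ℝ (Fin n)) :
    gaussianDensity v 0 z ≤ (2 * Real.pi * v) ^ (-(n : ℝ) / 2) := by
  unfold gaussianDensity
  refine mul_le_of_le_one_right (by positivity) (Real.exp_le_one_iff.2 ?_)
  rw [neg_div]
  exact neg_nonpos.2 (by positivity)

/-- From `u ≤ e^u` with `u = ‖z‖²/(2v)`. It dominates the quadratic factor that appears when the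
Gaussian is differentiated twice. -/
lemma gaussianDensity_zero_mul_norm_sq_le (hv : 0 < v) (z : EuclideanSpace ℝ (Fin n)) :
    gaussianDensity v 0 z * ‖z‖ ^ 2 ≤ (2 * Real.pi * v) ^ (-(n : ℝ) / 2) * (2 * v) := by
  unfold gaussianDensity
  rw [mul_assoc, sub_zero]
  refine mul_le_mul_of_nonneg_left ?_ (by positivity)
  have h := Real.add_one_le_exp (‖z‖ ^ 2 / (2 * v))
  rw [neg_div, Real.exp_neg, inv_mul_le_iff₀ (Real.exp_pos _)]
  have h2 : ‖z‖ ^ 2 = ‖z‖ ^ 2 / (2 * v) * (2 * v) := by field_simp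
  rw [h2]
  refine mul_le_mul_of_nonneg_right ?_ (by positivity)
  rw [← h2]
  linarith

lemma hasFDerivAt_gaussianDensity_zero (z : EuclideanSpace ℝ (Fin n)) :
    HasFDerivAt (gaussianDensity v 0) (-(gaussianDensity v 0 z / v) • innerSL ℝ z) z := by
  have h1 : HasFDerivAt (fun x : EuclideanSpace ℝ (Fin n) => ‖x‖ ^ 2) (2 • innerSL ℝ z) z :=
    (hasStrictFDerivAt_norm_sq z).hasFDerivAt
  have h2 := ((h1.neg.mul_const (2 * v)⁻¹).exp).const_mul ((2 * Real.pi * v) ^ (-(n : ℝ) / 2))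
  have h3 : gaussianDensity (n := n) v 0 = fun x =>
      (2 * Real.pi * v) ^ (-(n : ℝ) / 2) * Real.exp (-‖x‖ ^ 2 * (2 * v)⁻¹) := by
    ext x; simp [gaussianDensity, div_eq_mul_inv]
  rw [h3]
  refine h2.congr_fderiv ?_
  ext y
  simp
  ring

end Gaussian

section Density

variable {n : ℕ} {pH : EuclideanSpace ℝ (Fin n) → ℝ} {t : ℝ}

lemma one_sub_exp_neg_pos (ht : 0 < t) : 0 < 1 - Real.exp (-t) := by
  simpa using ht

/-- The gradient of the marginal density of the VP process. -/
noncomputable def vpDensityGradient (pH : EuclideanSpace ℝ (Fin n) → ℝ) (t : ℝ)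
    (x : EuclideanSpace ℝ (Fin n)) : EuclideanSpace ℝ (Fin n) :=
  ∫ y, pH y • (-(gaussianDensity (1 - Real.exp (-t)) 0 (x - Real.exp (-t / 2) • y)
    / (1 - Real.exp (-t))) • (x - Real.exp (-t / 2) • y))

lemma norm_smul_gaussianDensity_le {v : ℝ} (hv : 0 < v) (z : EuclideanSpace ℝ (Fin n)) :
    ‖-(gaussianDensity v 0 z / v) • z‖ ≤ (2 * Real.pi * v) ^ (-(n : ℝ) / 2) * (1 + 2 * v) / v := by
  have hg := gaussianDensity_zero_pos hv z
  have h1 : ‖-(gaussianDensity v 0 z / v) • z‖ = gaussianDensity v 0 z * ‖z‖ / v := by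
    rw [norm_smul, norm_neg, Real.norm_of_nonneg (by positivity)]
    ring
  rw [h1]
  refine div_le_div_of_nonneg_right ?_ hv.le
  have h2 := gaussianDensity_zero_le hv z
  have h3 := gaussianDensity_zero_mul_norm_sq_le hv z
  have h4 : ‖z‖ ≤ 1 + ‖z‖ ^ 2 := by nlinarith [sq_nonneg (‖z‖ - 1), norm_nonneg z]
  nlinarith [mul_le_mul_of_nonneg_left h4 hg.le]

lemma integrable_vpDensity_integrand (hpH : Integrable pH) (ht : 0 < t)
    (x : EuclideanSpace ℝ (Fin n)) :
    Integrable fun y => pH y * gaussianDensity (1 - Real.exp (-t)) 0 (x - Real.exp (-t / 2) • y) := by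
  have hv := one_sub_exp_neg_pos ht
  refine hpH.mul_bdd (c := (2 * Real.pi * (1 - Real.exp (-t))) ^ (-(n : ℝ) / 2))
    (Continuous.aestronglyMeasurable ?_) (.of_forall fun y => ?_)
  · exact continuous_gaussianDensity_zero.comp (by fun_prop)
  · rw [Real.norm_of_nonneg (gaussianDensity_zero_pos hv _).le]
    exact gaussianDensity_zero_le hv _

lemma vpDensity_pos (hpH : Integrable pH) (hpos : ∀ x, 0 < pH x) (ht : 0 < t)
    (x : EuclideanSpace ℝ (Fin n)) : 0 < vpDensity pH t x := by
  have hv := one_sub_exp_neg_pos ht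
  have hp : ∀ y, 0 < pH y * gaussianDensity (1 - Real.exp (-t)) 0 (x - Real.exp (-t / 2) • y) :=
    fun y => mul_pos (hpos y) (gaussianDensity_zero_pos hv _)
  rw [vpDensity, integral_pos_iff_support_of_nonneg (fun y => (hp y).le)
    (integrable_vpDensity_integrand hpH ht x)]
  have : (Function.support fun y =>
      pH y * gaussianDensity (1 - Real.exp (-t)) 0 (x - Real.exp (-t / 2) • y)) = univ := by
    ext y; simpa using (hp y).ne'
  rw [this]
  exact Measure.measure_univ_pos.2 (NeZero.ne _)

lemma hasFDerivAt_vpDensity (hpH : Integrable pH) (ht : 0 < t) (x : EuclideanSpace ℝ (Fin n)) :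
    HasFDerivAt (vpDensity pH t) (innerSL ℝ (vpDensityGradient pH t x)) x := by
  have hv := one_sub_exp_neg_pos ht
  set v := 1 - Real.exp (-t)
  have hcont : Continuous fun z : EuclideanSpace ℝ (Fin n) =>
      -(gaussianDensity v 0 z / v) • innerSL ℝ z :=
    ((continuous_gaussianDensity_zero.div_const v).neg).smul (innerSL ℝ).continuous
  have hbd : ∀ z : EuclideanSpace ℝ (Fin n), ‖-(gaussianDensity v 0 z / v) • innerSL ℝ z‖ ≤
      (2 * Real.pi * v) ^ (-(n : ℝ) / 2) * (1 + 2 * v) / v := fun z => by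
    have := norm_smul_gaussianDensity_le hv z
    rw [norm_smul] at this ⊢
    rwa [innerSL_apply_norm]
  have h := hasFDerivAt_integral_smul_comp_sub hpH (g := gaussianDensity v 0)
    hasFDerivAt_gaussianDensity_zero hcont
    (fun z => by
      rw [Real.norm_of_nonneg (gaussianDensity_zero_pos hv z).le]
      exact gaussianDensity_zero_le hv z) hbd (Real.exp (-t / 2)) x
  refine h.congr_fderiv ?_
  have hint : Integrable fun y => pH y • (-(gaussianDensity v 0 (x - Real.exp (-t / 2) • y) / v) •
      (x - Real.exp (-t / 2) • y)) := by
    refine (hpH.norm.mul_const ((2 * Real.pi * v) ^ (-(n : ℝ) / 2) * (1 + 2 * v) / v)).mono'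
      (hpH.aestronglyMeasurable.smul (Continuous.aestronglyMeasurable ?_)) (.of_forall fun y => ?_)
    · have := continuous_gaussianDensity_zero (n := n) (v := v)
      fun_prop
    · rw [norm_smul]
      exact mul_le_mul_of_nonneg_left (norm_smul_gaussianDensity_le hv _) (norm_nonneg _)
  rw [vpDensityGradient, ← ContinuousLinearMap.integral_comp_comm _ hint]
  simp [v]

/-- The score is this gradient divided by the density, so this second differentiation under the
integral is what makes the score differentiable. -/
lemma differentiable_vpDensityGradient (hpH : Integrable pH) (ht : 0 < t) :
    Differentiable ℝ (vpDensityGradient pH t) := by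
  have hv := one_sub_exp_neg_pos ht
  set v := 1 - Real.exp (-t)
  intro x
  have hd : ∀ z : EuclideanSpace ℝ (Fin n),
      HasFDerivAt (fun z => -(gaussianDensity v 0 z / v) • z)
        (-(gaussianDensity v 0 z / v) • ContinuousLinearMap.id ℝ _ +
          ((gaussianDensity v 0 z / v ^ 2) • innerSL ℝ z).smulRight z) z := by
    intro z
    have h1 : HasFDerivAt (fun z => -(gaussianDensity v 0 z / v))
        ((gaussianDensity v 0 z / v ^ 2) • innerSL ℝ z) z := by
      have := ((hasFDerivAt_gaussianDensity_zero (v := v) z).mul_const (v⁻¹)).neg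
      refine (this.congr_fderiv ?_)
      ext y
      simp
      ring_nf
    exact h1.smul (hasFDerivAt_id z)
  have hcont : Continuous fun z : EuclideanSpace ℝ (Fin n) =>
      -(gaussianDensity v 0 z / v) • ContinuousLinearMap.id ℝ (EuclideanSpace ℝ (Fin n)) +
          ((gaussianDensity v 0 z / v ^ 2) • innerSL ℝ z).smulRight z := by
    have hc := continuous_gaussianDensity_zero (n := n) (v := v)
    have hi : Continuous fun z : EuclideanSpace ℝ (Fin n) => innerSL ℝ z := (innerSL ℝ).continuous
    have : ∀ z : EuclideanSpace ℝ (Fin n),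
        ((gaussianDensity v 0 z / v ^ 2) • innerSL ℝ z).smulRight z =
        ContinuousLinearMap.smulRightL ℝ _ _ ((gaussianDensity v 0 z / v ^ 2) • innerSL ℝ z) z :=
      fun z => rfl
    simp only [this]
    fun_prop
  refine (hasFDerivAt_integral_smul_comp_sub hpH hd hcont (norm_smul_gaussianDensity_le hv)
    (C := (2 * Real.pi * v) ^ (-(n : ℝ) / 2) / v +
      (2 * Real.pi * v) ^ (-(n : ℝ) / 2) * (2 * v) / v ^ 2) (fun z => ?_)
    (Real.exp (-t / 2)) x).differentiableAt
  have hg := gaussianDensity_zero_pos hv z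
  refine (norm_add_le _ _).trans (add_le_add ?_ ?_)
  · rw [norm_smul, norm_neg, Real.norm_of_nonneg (by positivity)]
    calc _ ≤ gaussianDensity v 0 z / v * 1 :=
          mul_le_mul_of_nonneg_left ContinuousLinearMap.norm_id_le (by positivity)
      _ ≤ _ := by
          rw [mul_one]
          exact div_le_div_of_nonneg_right (gaussianDensity_zero_le hv z) hv.le
  · rw [ContinuousLinearMap.norm_smulRight_apply, norm_smul, innerSL_apply_norm,
      Real.norm_of_nonneg (by positivity)]
    have := gaussianDensity_zero_mul_norm_sq_le hv z
    calc _ = gaussianDensity v 0 z * ‖z‖ ^ 2 / v ^ 2 := by ring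
      _ ≤ _ := div_le_div_of_nonneg_right this (by positivity)

lemma hasFDerivAt_log_vpDensity (hpH : Integrable pH) (hpos : ∀ x, 0 < pH x) (ht : 0 < t)
    (x : EuclideanSpace ℝ (Fin n)) :
    HasFDerivAt (fun z => Real.log (vpDensity pH t z)) (innerSL ℝ (vpScore pH t x)) x := by
  have h := (hasFDerivAt_vpDensity hpH ht x).log (vpDensity_pos hpH hpos ht x).ne'
  have h2 := h.differentiableAt.hasGradientAt
  exact h2.hasFDerivAt

lemma vpScore_eq (hpH : Integrable pH) (hpos : ∀ x, 0 < pH x) (ht : 0 < t) :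
    vpScore pH t = fun x => (vpDensity pH t x)⁻¹ • vpDensityGradient pH t x := by
  ext1 x
  have h := (hasFDerivAt_vpDensity hpH ht x).log (vpDensity_pos hpH hpos ht x).ne'
  have h2 := (hasFDerivAt_log_vpDensity hpH hpos ht x).unique h
  rw [← map_smul] at h2
  exact innerSL_inj.1 h2

lemma differentiable_vpScore (hpH : Integrable pH) (hpos : ∀ x, 0 < pH x) (ht : 0 < t) :
    Differentiable ℝ (vpScore pH t) := by
  rw [vpScore_eq hpH hpos ht]
  have h1 : Differentiable ℝ (vpDensity pH t) := fun x =>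
    (hasFDerivAt_vpDensity hpH ht x).differentiableAt
  exact (h1.inv fun x => (vpDensity_pos hpH hpos ht x).ne').smul
    (differentiable_vpDensityGradient hpH ht)

end Density

/-! ### Hessian bounds from second differences -/

/-- A function with second differences bounded by `K r²` at `0` has second derivative at most
`K` there. -/
lemma second_deriv_le_of_second_difference_le {φ ψ : ℝ → ℝ} {c K : ℝ}
    (hφ : ∀ r, HasDerivAt φ (ψ r) r) (hψ : HasDerivAt ψ c 0)
    (h : ∀ r, φ r + φ (-r) - 2 * φ 0 ≤ K * r ^ 2) : c ≤ K := by
  by_contra! hcK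
  -- Here `u ≤ 0` and `u(0) = u'(0) = 0`, while `u''(0) = 2(c - K) > 0` would force `u` to increase
  -- strictly to the right of `0`.
  let u : ℝ → ℝ := fun r => φ r + φ (-r) - 2 * φ 0 - K * r ^ 2
  let u' : ℝ → ℝ := fun r => ψ r - ψ (-r) - 2 * K * r
  have hu : ∀ r, HasDerivAt u (u' r) r := by
    intro r
    have h1 : HasDerivAt (fun r => φ (-r)) (-ψ (-r)) r := by
      simpa [Function.comp_def] using (hφ (-r)).scomp r (hasDerivAt_neg r)
    have h2 := (((hφ r).add h1).sub_const (2 * φ 0)).sub ((hasDerivAt_pow 2 r).const_mul K)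
    refine h2.congr_deriv ?_
    simp only [u']
    norm_num
    ring
  have hu' : HasDerivAt u' (2 * (c - K)) 0 := by
    have h1 : HasDerivAt (fun r => ψ (-r)) (-c) 0 := by
      have h0 : HasDerivAt ψ c (-0) := by simpa using hψ
      simpa [Function.comp_def] using h0.scomp 0 (hasDerivAt_neg 0)
    have h2 := (hψ.sub h1).sub ((hasDerivAt_id (0 : ℝ)).const_mul (2 * K))
    refine h2.congr_deriv ?_
    ring
  have hu'0 : u' 0 = 0 := by simp [u']
  have hu0 : u 0 = 0 := by simp [u]; ring
  have hpos : ∀ᶠ r in nhdsWithin (0 : ℝ) (Ioi 0), 0 < u' r := by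
    have h1 := (hasDerivAt_iff_tendsto_slope.1 hu').mono_left
      (nhdsWithin_mono 0 fun x (hx : x ∈ Ioi (0 : ℝ)) => hx.ne')
    filter_upwards [h1.eventually_const_lt (show 0 < 2 * (c - K) by linarith),
      self_mem_nhdsWithin] with r hr hr0
    rw [slope_def_field, hu'0, sub_zero, sub_zero] at hr
    exact (div_pos_iff_of_pos_right hr0).1 hr
  obtain ⟨ε, hε, hεu⟩ := mem_nhdsGT_iff_exists_Ioo_subset.1 hpos
  have hε0 : (0 : ℝ) < ε := hε
  have hmono : StrictMonoOn u (Icc 0 (ε / 2)) := by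
    refine strictMonoOn_of_deriv_pos (convex_Icc _ _)
      (fun r _ => (hu r).continuousAt.continuousWithinAt) fun r hr => ?_
    rw [interior_Icc] at hr
    rw [(hu r).deriv]
    exact hεu ⟨hr.1, hr.2.trans (by linarith)⟩
  have h1 := hmono (left_mem_Icc.2 (by positivity)) (right_mem_Icc.2 (by positivity))
    (show (0 : ℝ) < ε / 2 by positivity)
  have h2 := h (ε / 2)
  rw [hu0] at h1
  simp only [u] at h1
  linarith

/-- The operator norm of a symmetric operator is controlled by its quadratic form. -/
lemma ContinuousLinearMap.opNorm_le_of_abs_inner_self_le {E : Type*} [NormedAddCommGroup E]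
    [InnerProductSpace ℝ E] {T : E →L[ℝ] E} (hT : ∀ v w, inner ℝ (T v) w = inner ℝ (T w) v)
    {C : ℝ} (hC : 0 ≤ C) (h : ∀ v, |inner ℝ (T v) v| ≤ C * ‖v‖ ^ 2) : ‖T‖ ≤ C := by
  refine T.opNorm_le_bound hC fun v => ?_
  by_cases hTv : T v = 0
  · rw [hTv, norm_zero]; positivity
  have hTv' : 0 < ‖T v‖ := norm_pos_iff.2 hTv
  have hv : 0 < ‖v‖ := norm_pos_iff.2 fun h0 => hTv (by simp [h0])
  -- Rescaling `T v` to length `‖v‖` gives `⟪T v, w⟫ = ‖v‖ ‖T v‖`. Polarisation over `v ± w` and the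
  -- parallelogram law bound this by `C ‖v‖²`.
  set w := (‖v‖ / ‖T v‖) • T v with hw
  have hwn : ‖w‖ = ‖v‖ := by
    rw [hw, norm_smul, Real.norm_of_nonneg (by positivity)]
    field_simp
  have hin : inner ℝ (T v) w = ‖v‖ * ‖T v‖ := by
    rw [hw, inner_smul_right, real_inner_self_eq_norm_sq]
    field_simp
  have h1 := (abs_le.1 (h (v + w))).2
  have h2 := (abs_le.1 (h (v - w))).1
  have h3 := parallelogram_law_with_norm ℝ v w
  have h4 := hT v w
  simp only [map_add, map_sub, inner_add_left, inner_add_right, inner_sub_left,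
    inner_sub_right] at h1 h2
  have h5 : 4 * (‖v‖ * ‖T v‖) ≤ C * (‖v + w‖ ^ 2 + ‖v - w‖ ^ 2) := by
    rw [← hin]; nlinarith
  rw [h3, hwn] at h5
  have h6 : ‖v‖ * ‖T v‖ ≤ ‖v‖ * (C * ‖v‖) := by nlinarith
  exact le_of_mul_le_mul_left h6 hv

/-- A `C²` function with nonnegative Hessian is midpoint convex. -/
lemma two_mul_apply_midpoint_le {E : Type*} [NormedAddCommGroup E] [NormedSpace ℝ E]
    {V : E → ℝ} (hV : ContDiff ℝ 2 V)
    (hconv : ∀ x v : E, 0 ≤ fderiv ℝ (fderiv ℝ V) x v v) (x y : E) :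
    2 * V ((2⁻¹ : ℝ) • (x + y)) ≤ V x + V y := by
  have hl : ∀ r : ℝ, HasDerivAt (fun r : ℝ => x + r • (y - x)) (y - x) r := fun r => by
    simpa using ((hasDerivAt_id r).smul_const (y - x)).const_add x
  have h1 : ∀ r : ℝ, HasDerivAt (fun r : ℝ => V (x + r • (y - x)))
      (fderiv ℝ V (x + r • (y - x)) (y - x)) r := fun r =>
    ((hV.differentiable (by norm_num)).differentiableAt.hasFDerivAt).comp_hasDerivAt r (hl r)
  have hV' : Differentiable ℝ (fderiv ℝ V) :=
    (hV.fderiv_right (m := 1) (by norm_num)).differentiable (by norm_num)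
  have h2 : ∀ r : ℝ, HasDerivAt (fun r : ℝ => fderiv ℝ V (x + r • (y - x)) (y - x))
      (fderiv ℝ (fderiv ℝ V) (x + r • (y - x)) (y - x) (y - x)) r := fun r => by
    have := (hV'.differentiableAt.hasFDerivAt).comp_hasDerivAt r (hl r)
    simpa using this.clm_apply (hasDerivAt_const r (y - x))
  have hc : ConvexOn ℝ univ fun r : ℝ => V (x + r • (y - x)) := by
    refine convexOn_univ_of_deriv2_nonneg (fun r => (h1 r).differentiableAt) ?_ fun r => ?_
    · rw [show deriv (fun r : ℝ => V (x + r • (y - x))) = _ from funext fun r => (h1 r).deriv]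
      exact fun r => (h2 r).differentiableAt
    · rw [Function.iterate_succ, Function.iterate_one, Function.comp,
        show deriv (fun r : ℝ => V (x + r • (y - x))) = _ from funext fun r => (h1 r).deriv,
        (h2 r).deriv]
      exact hconv _ _
  have := hc.2 (mem_univ 0) (mem_univ 1) (show (0 : ℝ) ≤ 2⁻¹ by norm_num)
    (show (0 : ℝ) ≤ 2⁻¹ by norm_num) (by norm_num)
  simp only [smul_eq_mul, mul_zero, mul_one, zero_add, zero_smul, one_smul, add_zero,
    add_sub_cancel] at this
  have he : x + (2⁻¹ : ℝ) • (y - x) = (2⁻¹ : ℝ) • (x + y) := by module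
  rw [he] at this
  linarith

section Gaussian

variable {n : ℕ} {v : ℝ}

lemma gaussianDensity_zero_mul_le (hv : 0 < v) (u w : EuclideanSpace ℝ (Fin n)) :
    gaussianDensity v 0 u * gaussianDensity v 0 w ≤
      gaussianDensity v 0 ((2⁻¹ : ℝ) • (u + w)) ^ 2 := by
  unfold gaussianDensity
  simp only [sub_zero]
  rw [mul_mul_mul_comm, mul_pow, ← sq, ← Real.exp_add, sq (Real.exp _), ← Real.exp_add]
  refine mul_le_mul_of_nonneg_left (Real.exp_le_exp.2 ?_) (by positivity)
  rw [← add_div, ← add_div]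
  refine div_le_div_of_nonneg_right ?_ (by positivity)
  have h := parallelogram_law_with_norm ℝ u w
  rw [norm_smul, mul_pow]
  norm_num
  nlinarith [sq_nonneg ‖u - w‖]

/-- The parallelogram law makes the log-concavity defect of the Gaussian exact and independent of
`u`; this exactness gives the lower Hessian bound. -/
lemma gaussianDensity_zero_add_mul_sub (u h : EuclideanSpace ℝ (Fin n)) :
    gaussianDensity v 0 (u + h) * gaussianDensity v 0 (u - h) =
      (gaussianDensity v 0 u * Real.exp (-(‖h‖ ^ 2 / (2 * v)))) ^ 2 := by
  unfold gaussianDensity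
  simp only [sub_zero]
  rw [mul_mul_mul_comm, mul_pow, mul_pow, ← sq, ← Real.exp_add, mul_assoc, sq (Real.exp _),
    ← Real.exp_add, sq (Real.exp (-(_ / _))), ← Real.exp_add, mul_assoc, ← Real.exp_add]
  congr 2
  linear_combination (-(2 * v)⁻¹) * parallelogram_law_with_norm ℝ u h

end Gaussian

section Density

variable {n : ℕ} {pH : EuclideanSpace ℝ (Fin n) → ℝ} {t : ℝ}

/-- The marginal density is midpoint log-concave if the initial density is. -/
lemma vpDensity_add_mul_sub_le_sq (hpH : Integrable pH) (hm : Measurable pH)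
    (hpos : ∀ x, 0 < pH x)
    (hlc : ∀ x y, pH x * pH y ≤ pH ((2⁻¹ : ℝ) • (x + y)) ^ 2)
    (ht : 0 < t) (x h : EuclideanSpace ℝ (Fin n)) :
    vpDensity pH t (x + h) * vpDensity pH t (x - h) ≤ vpDensity pH t x ^ 2 := by
  have hv := one_sub_exp_neg_pos ht
  have hofReal : ∀ z, ENNReal.ofReal (vpDensity pH t z) = ∫⁻ y, ENNReal.ofReal
      (pH y * gaussianDensity (1 - Real.exp (-t)) 0 (z - Real.exp (-t / 2) • y)) := fun z =>
    ofReal_integral_eq_lintegral_ofReal (integrable_vpDensity_integrand hpH ht z)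
      (.of_forall fun y => (mul_pos (hpos y) (gaussianDensity_zero_pos hv _)).le)
  have hmeas : ∀ z, Measurable fun y => ENNReal.ofReal
      (pH y * gaussianDensity (1 - Real.exp (-t)) 0 (z - Real.exp (-t / 2) • y)) := fun z => by
    refine (hm.mul (Continuous.measurable ?_)).ennreal_ofReal
    exact continuous_gaussianDensity_zero.comp (by fun_prop)
  -- The pair `(x, (y + z)/2)` is the midpoint of `(x + h, y)` and `(x - h, z)`, so joint
  -- log-concavity of the integrand is the hypothesis needed.
  have key := EuclideanSpace.lintegral_mul_lintegral_le_sq (hmeas (x + h)) (hmeas (x - h))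
    (hmeas x) fun y z => by
      rw [← ENNReal.ofReal_mul (mul_pos (hpos y) (gaussianDensity_zero_pos hv _)).le,
        ← ENNReal.ofReal_pow (mul_pos (hpos _) (gaussianDensity_zero_pos hv _)).le]
      refine ENNReal.ofReal_le_ofReal ?_
      rw [mul_mul_mul_comm, mul_pow]
      refine mul_le_mul (hlc y z) ?_ (mul_nonneg (gaussianDensity_zero_pos hv _).le
        (gaussianDensity_zero_pos hv _).le) (by positivity)
      have e : x - Real.exp (-t / 2) • (2⁻¹ : ℝ) • (y + z) = (2⁻¹ : ℝ) •
          ((x + h - Real.exp (-t / 2) • y) + (x - h - Real.exp (-t / 2) • z)) := by module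
      rw [e]
      exact gaussianDensity_zero_mul_le hv _ _
  rw [← hofReal, ← hofReal, ← hofReal, ← ENNReal.ofReal_mul (vpDensity_pos hpH hpos ht _).le,
    ← ENNReal.ofReal_pow (vpDensity_pos hpH hpos ht _).le] at key
  exact (ENNReal.ofReal_le_ofReal_iff (by positivity)).1 key

/-- Midpoint convexity of `log p_t + ‖x‖²/(2v)`: equality holds for each Gaussian kernel, and
Cauchy–Schwarz carries it through the mixture. Log-concavity of `pH` plays no role. -/
lemma vpDensity_sq_mul_exp_le (hpH : Integrable pH) (hpos : ∀ x, 0 < pH x) (ht : 0 < t)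
    (x h : EuclideanSpace ℝ (Fin n)) :
    (vpDensity pH t x * Real.exp (-(‖h‖ ^ 2 / (2 * (1 - Real.exp (-t)))))) ^ 2 ≤
      vpDensity pH t (x + h) * vpDensity pH t (x - h) := by
  have hv := one_sub_exp_neg_pos ht
  set v := 1 - Real.exp (-t)
  set e := Real.exp (-(‖h‖ ^ 2 / (2 * v)))
  have hp := vpDensity_pos hpH hpos ht (x + h)
  have hq := vpDensity_pos hpH hpos ht (x - h)
  set p := vpDensity pH t (x + h) with hpdef
  set q := vpDensity pH t (x - h) with hqdef
  -- Cauchy–Schwarz in the form of an optimised arithmetic–geometric mean inequality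
  have key : ∀ l : ℝ, 0 < l → 2 * (vpDensity pH t x * e) ≤ l * p + l⁻¹ * q := by
    intro l hl
    have h1 : 2 * (vpDensity pH t x * e) = ∫ y, 2 * (pH y * gaussianDensity v 0
        (x - Real.exp (-t / 2) • y) * e) := by
      rw [integral_const_mul, integral_mul_const, vpDensity]
    have h2 : l * p + l⁻¹ * q = ∫ y,
        (l * (pH y * gaussianDensity v 0 (x + h - Real.exp (-t / 2) • y)) +
          l⁻¹ * (pH y * gaussianDensity v 0 (x - h - Real.exp (-t / 2) • y))) := by
      rw [integral_add ((integrable_vpDensity_integrand hpH ht _).const_mul _)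
        ((integrable_vpDensity_integrand hpH ht _).const_mul _), integral_const_mul,
        integral_const_mul, hpdef, hqdef, vpDensity, vpDensity]
    rw [h1, h2]
    refine integral_mono (((integrable_vpDensity_integrand hpH ht _).mul_const _).const_mul _)
      (((integrable_vpDensity_integrand hpH ht _).const_mul _).add
        ((integrable_vpDensity_integrand hpH ht _).const_mul _)) fun y => ?_
    set u := x - Real.exp (-t / 2) • y with hu
    have e1 : x + h - Real.exp (-t / 2) • y = u + h := by rw [hu]; abel
    have e2 : x - h - Real.exp (-t / 2) • y = u - h := by rw [hu]; abel
    simp only [e1, e2]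
    have h3 := gaussianDensity_zero_add_mul_sub (v := v) u h
    have g1 := gaussianDensity_zero_pos hv (u + h)
    have g2 := gaussianDensity_zero_pos hv (u - h)
    have h4 : 2 * (gaussianDensity v 0 u * e) ≤
        l * gaussianDensity v 0 (u + h) + l⁻¹ * gaussianDensity v 0 (u - h) := by
      refine le_of_sq_le_sq ?_ (by positivity)
      have h5 : (l * gaussianDensity v 0 (u + h)) * (l⁻¹ * gaussianDensity v 0 (u - h)) =
          (gaussianDensity v 0 u * e) ^ 2 := by
        rw [← h3]; field_simp
      nlinarith [sq_nonneg (l * gaussianDensity v 0 (u + h) - l⁻¹ * gaussianDensity v 0 (u - h))]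
    have := mul_le_mul_of_nonneg_left h4 (hpos y).le
    nlinarith
  -- This `l` minimises `l p + q / l`, whose minimum is `2 √(p q)`.
  have h1 := key (√(q / p)) (by positivity)
  have hs : √(q / p) ^ 2 = q / p := Real.sq_sqrt (by positivity)
  have hs0 : 0 < √(q / p) := by positivity
  have h2 : √(q / p) * p + (√(q / p))⁻¹ * q = 2 * (√(q / p) * p) := by
    have : q = √(q / p) ^ 2 * p := by rw [hs]; field_simp
    field_simp
    linarith
  have h3 : vpDensity pH t x * e ≤ √(q / p) * p := by linarith
  have h4 : (√(q / p) * p) ^ 2 = p * q := by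
    rw [mul_pow, hs]; field_simp
  rw [← h4]
  have := vpDensity_pos hpH hpos ht x
  gcongr

/-- For a log-concave initial density, `-1/(1 - e⁻ᵗ) ≤ ∇s_t ≤ 0`, so that the operator norm of
`∇s_t` is at most `1/(1 - e⁻ᵗ)`. -/
theorem norm_fderiv_vpScore_le (hpH : Integrable pH) (hm : Measurable pH)
    (hpos : ∀ x, 0 < pH x)
    (hlc : ∀ x y, pH x * pH y ≤ pH ((2⁻¹ : ℝ) • (x + y)) ^ 2)
    (ht : 0 < t) (x : EuclideanSpace ℝ (Fin n)) :
    ‖fderiv ℝ (vpScore pH t) x‖ ≤ 1 / (1 - Real.exp (-t)) := by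
  have hv := one_sub_exp_neg_pos ht
  have hs := differentiable_vpScore hpH hpos ht
  have hsx := (hs x).hasFDerivAt
  set T := fderiv ℝ (vpScore pH t) x with hT
  have hlog := fun z => hasFDerivAt_log_vpDensity hpH hpos ht z
  refine ContinuousLinearMap.opNorm_le_of_abs_inner_self_le (fun v w => ?_) (by positivity)
    fun v => ?_
  · have h := second_derivative_symmetric hlog ((innerSL ℝ).hasFDerivAt.comp x hsx) v w
    exact h
  have hl : ∀ r : ℝ, HasDerivAt (fun r : ℝ => x + r • v) v r := fun r => by
    simpa using ((hasDerivAt_id r).smul_const v).const_add x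
  have hφ : ∀ r : ℝ, HasDerivAt (fun r : ℝ => Real.log (vpDensity pH t (x + r • v)))
      (inner ℝ (vpScore pH t (x + r • v)) v) r := fun r =>
    (hlog (x + r • v)).comp_hasDerivAt (f := fun r : ℝ => x + r • v) r (hl r)
  have hψ : HasDerivAt (fun r : ℝ => inner ℝ (vpScore pH t (x + r • v)) v)
      (inner ℝ (T v) v) 0 := by
    have h0 : HasFDerivAt (vpScore pH t) T (x + (0 : ℝ) • v) := by simpa using hsx
    simpa using (h0.comp_hasDerivAt (0 : ℝ) (hl 0)).inner ℝ (hasDerivAt_const (0 : ℝ) v)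
  have hp := fun z => vpDensity_pos hpH hpos ht z
  rw [abs_le]
  constructor
  -- Lower Hessian bound: the logarithm of the Cauchy–Schwarz estimate bounds the second differences
  -- of `-log p_t` along `v`.
  · have := second_deriv_le_of_second_difference_le (fun r => (hφ r).neg) hψ.neg
      (K := 1 / (1 - Real.exp (-t)) * ‖v‖ ^ 2) fun r => by
        have h := Real.log_le_log (by have := hp x; positivity)
          (vpDensity_sq_mul_exp_le hpH hpos ht x (r • v))
        rw [Real.log_mul (hp _).ne' (hp _).ne', Real.log_pow,
          Real.log_mul (hp _).ne' (Real.exp_pos _).ne', Real.log_exp, norm_smul, mul_pow,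
          Real.norm_eq_abs, sq_abs] at h
        simp only [Pi.neg_apply, neg_smul, zero_smul, add_zero, ← sub_eq_add_neg]
        have e : ((2 : ℕ) : ℝ) * -(r ^ 2 * ‖v‖ ^ 2 / (2 * (1 - Real.exp (-t)))) =
            -(1 / (1 - Real.exp (-t)) * ‖v‖ ^ 2 * r ^ 2) := by
          push_cast
          field_simp
        rw [mul_add, e] at h
        push_cast at h
        linarith
    linarith
  -- Upper Hessian bound: log-concavity of `p_t` makes its logarithmic second differences
  -- nonpositive.
  · have := second_deriv_le_of_second_difference_le hφ hψ (K := 0) fun r => by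
        have h := Real.log_le_log (mul_pos (hp _) (hp _))
          (vpDensity_add_mul_sub_le_sq hpH hm hpos hlc ht x (r • v))
        rw [Real.log_mul (hp _).ne' (hp _).ne', Real.log_pow] at h
        simp only [neg_smul, zero_smul, add_zero, ← sub_eq_add_neg]
        push_cast at h
        linarith
    exact this.trans (by positivity)

end Density

/-! ### Fourier transform of the marginal density -/

section CharFun

variable {n : ℕ} {v : ℝ}

/-- The Gaussian Fourier transform. -/
lemma integral_gaussianDensity_zero_mul_cexp (hv : 0 < v) (ξ : EuclideanSpace ℝ (Fin n)) :
    ∫ x, (gaussianDensity v 0 x : ℂ) * Complex.exp (inner ℝ x ξ * Complex.I) =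
      Complex.exp (-(v * ‖ξ‖ ^ 2 / 2 : ℝ)) := by
  have hb : 0 < ((1 / (2 * v) : ℝ) : ℂ).re := by
    rw [Complex.ofReal_re]; positivity
  have h := GaussianFourier.integral_cexp_neg_mul_sq_norm_add hb Complex.I ξ
  have e : ∀ x : EuclideanSpace ℝ (Fin n),
      (gaussianDensity v 0 x : ℂ) * Complex.exp (inner ℝ x ξ * Complex.I) =
      (((2 * Real.pi * v) ^ (-(n : ℝ) / 2) : ℝ) : ℂ) *
        Complex.exp (-((1 / (2 * v) : ℝ) : ℂ) * ‖x‖ ^ 2 + Complex.I * inner ℝ ξ x) := by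
    intro x
    rw [gaussianDensity, sub_zero, Complex.ofReal_mul, Complex.ofReal_exp, mul_assoc,
      ← Complex.exp_add, real_inner_comm ξ x]
    congr 2
    push_cast
    ring
  simp_rw [e]
  rw [integral_const_mul, h, finrank_euclideanSpace_fin]
  have h2 : ((Real.pi : ℂ) / ((1 / (2 * v) : ℝ) : ℂ)) ^ ((n : ℂ) / 2) =
      (((2 * Real.pi * v) ^ ((n : ℝ) / 2) : ℝ) : ℂ) := by
    rw [← Complex.ofReal_div, Complex.ofReal_cpow (by positivity)]
    congr 1
    · congr 1
      field_simp
    · push_cast; ring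
  rw [h2, ← mul_assoc, ← Complex.ofReal_mul, ← Real.rpow_add (by positivity)]
  have h3 : -(n : ℝ) / 2 + n / 2 = 0 := by ring
  rw [h3, Real.rpow_zero, Complex.ofReal_one, one_mul, Complex.I_sq]
  congr 1
  push_cast
  have : (v : ℂ) ≠ 0 := by exact_mod_cast hv.ne'
  field_simp
  norm_num

lemma integrable_gaussianDensity_zero (hv : 0 < v) :
    Integrable (gaussianDensity (n := n) v 0) := by
  have h := GaussianFourier.integrable_cexp_neg_mul_sq_norm_add_of_euclideanSpace
    (ι := Fin n) (b := ((1 / (2 * v) : ℝ) : ℂ)) (by rw [Complex.ofReal_re]; positivity) 0 0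
  refine (h.norm.const_mul ((2 * Real.pi * v) ^ (-(n : ℝ) / 2))).congr (.of_forall fun x => ?_)
  simp only [gaussianDensity, sub_zero, zero_mul, add_zero]
  rw [Complex.norm_exp]
  congr 2
  rw [← Complex.ofReal_pow, ← Complex.ofReal_neg, ← Complex.ofReal_mul, Complex.ofReal_re]
  ring

variable {pH : EuclideanSpace ℝ (Fin n) → ℝ} {t : ℝ}

lemma integrable_uncurry_vpDensity_integrand (hpH : Integrable pH) (ht : 0 < t) :
    Integrable (Function.uncurry fun x y =>
      pH y * gaussianDensity (1 - Real.exp (-t)) 0 (x - Real.exp (-t / 2) • y))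
      (volume.prod volume) := by
  have hv := one_sub_exp_neg_pos ht
  have hG := integrable_gaussianDensity_zero (n := n) hv
  have hm : AEStronglyMeasurable (Function.uncurry fun x y =>
      pH y * gaussianDensity (1 - Real.exp (-t)) 0 (x - Real.exp (-t / 2) • y))
      ((volume : Measure (EuclideanSpace ℝ (Fin n))).prod volume) := by
    refine hpH.aestronglyMeasurable.comp_snd.mul (Continuous.aestronglyMeasurable ?_)
    exact continuous_gaussianDensity_zero.comp (by fun_prop)
  rw [integrable_prod_iff' hm]
  refine ⟨.of_forall fun y =>
    (hG.comp_sub_right (Real.exp (-t / 2) • y)).const_mul (pH y), ?_⟩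
  simp only [Function.uncurry_apply_pair, norm_mul, integral_const_mul]
  simp_rw [integral_sub_right_eq_self (fun x => ‖gaussianDensity (1 - Real.exp (-t)) 0 x‖)]
  exact hpH.norm.mul_const _

lemma integrable_vpDensity (hpH : Integrable pH) (ht : 0 < t) : Integrable (vpDensity pH t) :=
  (integrable_uncurry_vpDensity_integrand hpH ht).integral_prod_left

lemma charFun_densityMeasure {p : EuclideanSpace ℝ (Fin n) → ℝ} (hp : Integrable p)
    (hp0 : ∀ x, 0 ≤ p x) (ξ : EuclideanSpace ℝ (Fin n)) :
    charFun (densityMeasure p) ξ = ∫ x, (p x : ℂ) * Complex.exp (inner ℝ x ξ * Complex.I) := by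
  rw [charFun_apply, densityMeasure, integral_withDensity_eq_integral_toReal_smul₀
    hp.aemeasurable.ennreal_ofReal (.of_forall fun x => ENNReal.ofReal_lt_top)]
  simp only [ENNReal.toReal_ofReal (hp0 _), Complex.real_smul]

/-- After Fubini, the inner integral in `x` is the Fourier transform of a Gaussian translated by `a
y`; the translation contributes the phase that rebuilds the transform of `pH` at `a ξ`. -/
lemma charFun_densityMeasure_vpDensity (hpH : Integrable pH) (hpos : ∀ x, 0 < pH x) (ht : 0 < t)
    (ξ : EuclideanSpace ℝ (Fin n)) :
    charFun (densityMeasure (vpDensity pH t)) ξ =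
      charFun (densityMeasure pH) (Real.exp (-t / 2) • ξ) *
        Complex.exp (-((1 - Real.exp (-t)) * ‖ξ‖ ^ 2 / 2 : ℝ)) := by
  have hv := one_sub_exp_neg_pos ht
  set v := 1 - Real.exp (-t) with hvdef
  set a := Real.exp (-t / 2)
  rw [charFun_densityMeasure (integrable_vpDensity hpH ht)
    (fun x => (vpDensity_pos hpH hpos ht x).le), charFun_densityMeasure hpH (fun x => (hpos x).le)]
  have h1 : ∀ x, (vpDensity pH t x : ℂ) * Complex.exp (inner ℝ x ξ * Complex.I) =
      ∫ y, ((pH y * gaussianDensity v 0 (x - a • y) : ℝ) : ℂ) *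
        Complex.exp (inner ℝ x ξ * Complex.I) := fun x => by
    rw [integral_mul_const, vpDensity, integral_complex_ofReal]
  simp_rw [h1]
  rw [integral_integral_swap]
  · have h2 : ∀ y, ∫ x, ((pH y * gaussianDensity v 0 (x - a • y) : ℝ) : ℂ) *
        Complex.exp (inner ℝ x ξ * Complex.I) =
        (pH y * Complex.exp (inner ℝ y (a • ξ) * Complex.I)) *
          ∫ x, (gaussianDensity v 0 x : ℂ) * Complex.exp (inner ℝ x ξ * Complex.I) := by
      intro y
      rw [← integral_sub_right_eq_self (fun x => (gaussianDensity v 0 x : ℂ) *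
        Complex.exp (inner ℝ x ξ * Complex.I)) (a • y), ← integral_const_mul]
      congr 1 with x
      have : inner ℝ x ξ = inner ℝ y (a • ξ) + inner ℝ (x - a • y) ξ := by
        rw [inner_sub_left, inner_smul_left, inner_smul_right]
        simp
      rw [this, Complex.ofReal_add, add_mul, Complex.exp_add]
      push_cast
      ring
    simp_rw [h2, integral_gaussianDensity_zero_mul_cexp hv]
    rw [integral_mul_const]
  · refine Integrable.mono (integrable_uncurry_vpDensity_integrand hpH ht) ?_ (.of_forall ?_)
    · refine (Complex.continuous_ofReal.comp_aestronglyMeasurable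
        (integrable_uncurry_vpDensity_integrand hpH ht).aestronglyMeasurable).mul
        (Continuous.aestronglyMeasurable ?_)
      fun_prop
    · rintro ⟨x, y⟩
      simp [Complex.norm_exp_ofReal_mul_I, v, a]

end CharFun

/-! ### The law of the VP process through its Euler scheme -/

open Filter Topology in
/-- Convergence of the Euler scheme for the pathwise equation `x_t = x_0 - ½ ∫₀ᵗ x_s ds + w_t`. -/
lemma tendsto_euler_scheme {E : Type*} [NormedAddCommGroup E] [NormedSpace ℝ E] [CompleteSpace E]
    {x w : ℝ≥0 → E} (hx : Continuous x)
    (hsde : ∀ t : ℝ≥0, x t = x 0 - (1 / 2 : ℝ) • (∫ s in (0 : ℝ)..t, x s.toNNReal) + w t)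
    (t : ℝ≥0) :
    Tendsto (fun k : ℕ => (1 - (t : ℝ) / k / 2) ^ k • x 0 + ∑ j ∈ Finset.range k,
      (1 - (t : ℝ) / k / 2) ^ (k - 1 - j) • (w ((j + 1 : ℕ) * (t / k)) - w (j * (t / k))))
      atTop (𝓝 (x t)) := by
  set X : ℝ → E := fun s => x s.toNNReal with hX
  have hXc : Continuous X := hx.comp continuous_real_toNNReal
  have huc : UniformContinuousOn X (Icc 0 (t : ℝ)) :=
    isCompact_Icc.uniformContinuousOn_of_continuous hXc.continuousOn
  have hstep : ∀ r s : ℝ≥0, x s = x r - (1 / 2 : ℝ) • (∫ u in (r : ℝ)..s, X u) + (w s - w r) := by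
    intro r s
    have h : (∫ u in (0 : ℝ)..s, X u) - (∫ u in (0 : ℝ)..r, X u) = ∫ u in (r : ℝ)..s, X u :=
      intervalIntegral.integral_interval_sub_left (hXc.intervalIntegrable _ _)
        (hXc.intervalIntegrable _ _)
    rw [hsde s, hsde r, ← h, smul_sub]
    abel
  rw [Metric.tendsto_atTop]
  intro ε hε
  obtain ⟨δ, hδ, hδX⟩ := Metric.uniformContinuousOn_iff.1 huc (ε / (t + 1)) (by positivity)
  -- For `k ≥ N` the mesh `t / k` is below `δ`, and at most `1`, so that the Euler factor `q` lies
  -- in `[0, 1]`.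
  obtain ⟨N, hN⟩ := exists_nat_gt (max ((t : ℝ) / δ) (max 1 t))
  refine ⟨N, fun k hk => ?_⟩
  have hkN : max ((t : ℝ) / δ) (max 1 t) < k := hN.trans_le (by exact_mod_cast hk)
  have hk1 : (1 : ℝ) < k := lt_of_le_of_lt (le_trans (le_max_left _ _) (le_max_right _ _)) hkN
  have hkt : (t : ℝ) < k := lt_of_le_of_lt (le_trans (le_max_right _ _) (le_max_right _ _)) hkN
  have hkδ : (t : ℝ) / k < δ := by
    have : (t : ℝ) / δ < k := lt_of_le_of_lt (le_max_left _ _) hkN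
    rw [div_lt_iff₀ (by positivity)] at this ⊢
    linarith
  have hk0 : (0 : ℝ) < k := by linarith
  set Δ : ℝ := (t : ℝ) / k with hΔ
  have hΔ0 : 0 ≤ Δ := by positivity
  have hΔ1 : Δ ≤ 1 := by rw [hΔ, div_le_one hk0]; exact hkt.le
  set q : ℝ := 1 - Δ / 2 with hq
  have hq0 : 0 ≤ q := by linarith
  have hq1 : q ≤ 1 := by linarith
  set y : ℕ → E := fun m => q ^ m • x 0 + ∑ j ∈ Finset.range m,
    q ^ (m - 1 - j) • (w ((j + 1 : ℕ) * (t / k)) - w (j * (t / k))) with hy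
  have hysucc : ∀ m : ℕ, y (m + 1) = q • y m + (w ((m + 1 : ℕ) * (t / k)) - w (m * (t / k))) := by
    intro m
    simp only [hy]
    rw [Finset.sum_range_succ, smul_add, smul_smul, ← pow_succ', Finset.smul_sum, add_assoc]
    congr 1
    rw [Nat.add_sub_cancel, Nat.sub_self, pow_zero, one_smul]
    congr 1
    refine Finset.sum_congr rfl fun j hj => ?_
    have hj' := Finset.mem_range.1 hj
    rw [smul_smul, ← pow_succ']
    congr 2
    omega
  -- Each step contracts the old error by `q ≤ 1` and adds half the mesh times the oscillation of
  -- the path. After `k` steps the total is `(t/(t+1)) ε/2 < ε`.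
  have herr : ∀ m : ℕ, m ≤ k → ‖y m - x (m * (t / k))‖ ≤ m * (Δ * (ε / (t + 1)) / 2) := by
    intro m
    induction m with
    | zero => intro _; simp [hy]
    | succ m ih =>
      intro hmk
      have ih' := ih (by omega)
      have hmk' : ((m : ℝ) + 1) ≤ k := by exact_mod_cast hmk
      have hr : (((m : ℝ≥0) * (t / k) : ℝ≥0) : ℝ) = m * Δ := by push_cast; rfl
      have hs : ((((m + 1 : ℕ) : ℝ≥0) * (t / k) : ℝ≥0) : ℝ) = (m + 1) * Δ := by push_cast; rfl
      have hst := hstep (m * (t / k)) ((m + 1 : ℕ) * (t / k))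
      rw [hr, hs] at hst
      have hxr : x (m * (t / k)) = X (m * Δ) := by
        rw [hX, ← hr]; simp only [Real.toNNReal_coe]
      have hI : (∫ u in (m * Δ)..((m + 1) * Δ), X u) =
          (∫ u in (m * Δ)..((m + 1) * Δ), (X u - X (m * Δ))) + Δ • X (m * Δ) := by
        rw [intervalIntegral.integral_sub (hXc.intervalIntegrable _ _)
          (intervalIntegrable_const), intervalIntegral.integral_const]
        have : ((m : ℝ) + 1) * Δ - m * Δ = Δ := by ring
        rw [this]; abel
      have htop : ((m : ℝ) + 1) * Δ ≤ t := by
        calc ((m : ℝ) + 1) * Δ ≤ k * Δ := mul_le_mul_of_nonneg_right hmk' hΔ0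
          _ = t := by rw [hΔ]; field_simp
      have hm0 : 0 ≤ (m : ℝ) * Δ := by positivity
      have hIb : ‖∫ u in (m * Δ)..((m + 1) * Δ), (X u - X (m * Δ))‖ ≤ ε / (t + 1) * Δ := by
        refine (intervalIntegral.norm_integral_le_of_norm_le_const (C := ε / (t + 1))
          fun u hu => ?_).trans_eq ?_
        · rw [uIoc_of_le (by linarith)] at hu
          have h1 := hδX u ⟨hm0.trans hu.1.le, hu.2.trans htop⟩ (m * Δ) ⟨hm0, by linarith⟩ (by
            rw [Real.dist_eq, abs_of_pos (by linarith [hu.1])]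
            linarith [hu.2])
          rw [dist_eq_norm] at h1
          exact h1.le
        · rw [show ((m : ℝ) + 1) * Δ - m * Δ = Δ by ring, abs_of_nonneg hΔ0]
      have hdiff : y (m + 1) - x ((m + 1 : ℕ) * (t / k)) = q • (y m - x (m * (t / k))) +
          (1 / 2 : ℝ) • ∫ u in (m * Δ)..((m + 1) * Δ), (X u - X (m * Δ)) := by
        rw [hysucc, hst, hI, ← hxr, hq]
        module
      rw [hdiff]
      refine (norm_add_le _ _).trans ?_
      rw [norm_smul, norm_smul, Real.norm_of_nonneg hq0, Real.norm_of_nonneg (by norm_num)]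
      have h2 : q * ‖y m - x (m * (t / k))‖ ≤ ‖y m - x (m * (t / k))‖ :=
        mul_le_of_le_one_left (norm_nonneg _) hq1
      push_cast
      linarith
  have hfin := herr k le_rfl
  have hkk : (k : ℝ≥0) * (t / k) = t := by
    have : (k : ℝ≥0) ≠ 0 := by exact_mod_cast (by exact_mod_cast hk0.ne' : k ≠ 0)
    field_simp
  rw [hkk] at hfin
  rw [dist_eq_norm]
  refine hfin.trans_lt ?_
  have h3 : (k : ℝ) * (Δ * (ε / (t + 1)) / 2) = (t / (t + 1)) * (ε / 2) := by
    rw [hΔ]; field_simp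
  rw [h3]
  have h4 : (t : ℝ) / (t + 1) ≤ 1 := by
    rw [div_le_one (by positivity)]; linarith
  nlinarith

open Filter Topology in
/-- Convergence of the variance of the Euler scheme. -/
lemma tendsto_euler_variance (t : ℝ) :
    Tendsto (fun k : ℕ => ∑ j ∈ Finset.range k, ((1 - t / k / 2) ^ (k - 1 - j)) ^ 2 * (t / k))
      atTop (𝓝 (1 - Real.exp (-t))) := by
  have h0 : Tendsto (fun k : ℕ => t / (k : ℝ)) atTop (𝓝 0) := tendsto_const_div_atTop_nhds_zero_nat t
  have hq : Tendsto (fun k : ℕ => (1 - t / (k : ℝ) / 2) ^ k) atTop (𝓝 (Real.exp (-t / 2))) := by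
    refine (Real.tendsto_one_add_div_pow_exp (-t / 2)).congr fun k => ?_
    congr 1
    ring
  -- With `Δ = t/k` and `q = 1 - Δ/2`, `1 - q² = Δ(1 - Δ/4)`, so the geometric sum is `(1 -
  -- q^{2k})/(1 - Δ/4)`.
  have h1 : Tendsto (fun k : ℕ => (1 - ((1 - t / (k : ℝ) / 2) ^ k) ^ 2) / (1 - t / (k : ℝ) / 4))
      atTop (𝓝 (1 - Real.exp (-t))) := by
    have := ((tendsto_const_nhds (x := (1 : ℝ))).sub (hq.pow 2)).div
      ((tendsto_const_nhds (x := (1 : ℝ))).sub (h0.div_const 4)) (by norm_num)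
    have he : (1 - Real.exp (-t / 2) ^ 2) / (1 - 0 / 4) = 1 - Real.exp (-t) := by
      rw [← Real.exp_nat_mul, zero_div, sub_zero, div_one]
      congr 2
      push_cast
      ring
    rw [he] at this
    exact this
  refine h1.congr' ?_
  have h2 : ∀ᶠ k : ℕ in atTop, t / (k : ℝ) < 1 := h0.eventually_lt_const (by norm_num)
  filter_upwards [h2] with k hk
  have hne : 1 - t / (k : ℝ) / 4 ≠ 0 := by linarith
  rw [div_eq_iff hne, ← Finset.sum_mul]
  have hr := Finset.sum_range_reflect (fun j => ((1 - t / (k : ℝ) / 2) ^ j) ^ 2) k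
  rw [hr]
  have hg := geom_sum_mul ((1 - t / (k : ℝ) / 2) ^ 2) k
  simp_rw [← pow_mul, mul_comm 2] at hg
  simp_rw [← pow_mul]
  linear_combination hg

section Brownian

variable {Ω : Type*} [MeasurableSpace Ω] {P : Measure Ω}

/-- The characteristic function of a Wiener integral of a step function. -/
lemma IsPreBrownianReal.charFun_sum_mul_increments {B : ℝ≥0 → Ω → ℝ} (hB : IsPreBrownianReal B P)
    {τ : ℕ → ℝ≥0} (hτ : Monotone τ) (c : ℕ → ℝ) (k : ℕ) (s : ℝ) :
    charFun (P.map fun ω => ∑ j ∈ Finset.range k, c j * (B (τ (j + 1)) ω - B (τ j) ω)) s =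
      Complex.exp (-((∑ j ∈ Finset.range k, c j ^ 2 * (τ (j + 1) - τ j : ℝ)) * s ^ 2 / 2 : ℝ)) := by
  have hind : iIndepFun (fun (j : Fin k) ω => c j * (B (τ (j + 1)) ω - B (τ j) ω)) P :=
    ((hB.hasIndepIncrements.nat hτ).precomp Fin.val_injective).comp
      (fun (j : Fin k) x => c j * x) fun j => by fun_prop
  have hm : ∀ j : Fin k, AEMeasurable (fun ω => c j * (B (τ (j + 1)) ω - B (τ j) ω)) P := fun j =>
    ((hB.aemeasurable _).sub (hB.aemeasurable _)).const_mul _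
  have hlaw : ∀ j : Fin k,
      charFun (P.map fun ω => c j * (B (τ (j + 1)) ω - B (τ j) ω)) s =
        Complex.exp (-(c j ^ 2 * (τ (j + 1) - τ j : ℝ) * s ^ 2 / 2 : ℝ)) := by
    intro j
    have h1 := hB.hasLaw_sub (τ (j + 1)) (τ j)
    rw [charFun_map_mul_comp (f := fun ω => B (τ (j + 1)) ω - B (τ j) ω)
      ((hB.aemeasurable _).sub (hB.aemeasurable _))]
    have h2 : P.map (fun ω => B (τ (j + 1)) ω - B (τ j) ω) = _ := h1.map_eq
    have h3 : ((nndist (τ (j + 1) : ℝ) (τ j : ℝ) : ℝ≥0) : ℝ) = τ (j + 1) - τ j := by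
      rw [coe_nndist, Real.dist_eq, abs_of_nonneg]
      exact sub_nonneg.2 (by exact_mod_cast hτ (Nat.le_succ _))
    rw [h2, charFun_gaussianReal]
    congr 1
    simp only [NNReal.val_eq_coe]
    rw [h3]
    push_cast
    ring
  have := congrFun (hind.charFun_map_fun_sum_eq_prod hm) s
  simp only [Finset.sum_range]
  rw [this, Finset.prod_apply]
  simp_rw [hlaw]
  rw [← Complex.exp_sum]
  congr 1
  push_cast
  rw [Finset.sum_neg_distrib, Finset.sum_mul, Finset.sum_div]

variable {n : ℕ} {W : ℝ≥0 → Ω → EuclideanSpace ℝ (Fin n)}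

lemma IsBrownianVec.aemeasurable (hW : IsBrownianVec W P) (t : ℝ≥0) : AEMeasurable (W t) P := by
  have h : AEMeasurable (fun ω i => W t ω i) P :=
    aemeasurable_pi_iff.2 fun i => (hW.coord i).aemeasurable t
  exact (MeasurableEquiv.toLp 2 (Fin n → ℝ)).measurable.comp_aemeasurable h

lemma IsBrownianVec.charFun_sum_smul_increments (hW : IsBrownianVec W P)
    {τ : ℕ → ℝ≥0} (hτ : Monotone τ) (c : ℕ → ℝ) (k : ℕ) (ξ : EuclideanSpace ℝ (Fin n)) :
    charFun (P.map fun ω => ∑ j ∈ Finset.range k, c j • (W (τ (j + 1)) ω - W (τ j) ω)) ξ =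
      Complex.exp
        (-((∑ j ∈ Finset.range k, c j ^ 2 * (τ (j + 1) - τ j : ℝ)) * ‖ξ‖ ^ 2 / 2 : ℝ)) := by
  set S : Ω → EuclideanSpace ℝ (Fin n) := fun ω =>
    ∑ j ∈ Finset.range k, c j • (W (τ (j + 1)) ω - W (τ j) ω) with hS
  have hSm : AEMeasurable S P := Finset.aemeasurable_fun_sum _ fun j _ =>
    ((hW.aemeasurable (τ (j + 1))).sub (hW.aemeasurable (τ j))).const_smul (c j)
  have hSi : ∀ ω i, S ω i =
      ∑ j ∈ Finset.range k, c j * (W (τ (j + 1)) ω i - W (τ j) ω i) := by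
    intro ω i
    simp [hS]
  have hSim : ∀ i, AEMeasurable (fun ω => S ω i) P := fun i => by
    simp_rw [hSi]
    exact Finset.aemeasurable_fun_sum _ fun j _ =>
      (((hW.coord i).aemeasurable _).sub ((hW.coord i).aemeasurable _)).const_mul _
  have hind : iIndepFun (fun i ω => ξ i * S ω i) P := by
    have := hW.indep.comp (fun i (w : ℝ≥0 → ℝ) =>
      ξ i * ∑ j ∈ Finset.range k, c j * (w (τ (j + 1)) - w (τ j))) fun i => by fun_prop
    simp_rw [hSi]
    exact this
  -- Passing to the scalar variable `⟪ξ, S⟫` lets independence of the coordinates factor the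
  -- characteristic function.
  have h1 : charFun (P.map S) ξ = charFun (P.map fun ω => ∑ i, ξ i * S ω i) 1 := by
    rw [charFun_apply, charFun_apply, integral_map hSm (by fun_prop),
      integral_map (Finset.aemeasurable_fun_sum _ fun i _ => (hSim i).const_mul _) (by fun_prop)]
    congr 1 with ω
    simp [PiLp.inner_apply]
  rw [h1, hind.charFun_map_fun_sum_eq_prod fun i => (hSim i).const_mul _, Finset.prod_apply]
  have h2 : ∀ i, charFun (P.map fun ω => ξ i * S ω i) 1 = Complex.exp
      (-((∑ j ∈ Finset.range k, c j ^ 2 * (τ (j + 1) - τ j : ℝ)) * ξ i ^ 2 / 2 : ℝ)) := by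
    intro i
    rw [charFun_map_mul_comp (hSim i), mul_one]
    simp_rw [hSi]
    exact IsPreBrownianReal.charFun_sum_mul_increments (hW.coord i).toIsPreBrownianReal hτ c k _
  simp_rw [h2]
  rw [← Complex.exp_sum, EuclideanSpace.norm_sq_eq]
  congr 1
  simp only [Real.norm_eq_abs, sq_abs]
  push_cast
  rw [Finset.sum_neg_distrib, Finset.mul_sum, Finset.sum_div]

variable [IsProbabilityMeasure P] {pH : EuclideanSpace ℝ (Fin n) → ℝ}
  {X : ℝ≥0 → Ω → EuclideanSpace ℝ (Fin n)}

open Filter Topology in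
/-- The characteristic function of the VP process. -/
lemma IsVPProcess.charFun_map (hX : IsVPProcess pH X W P) (t : ℝ≥0)
    (ξ : EuclideanSpace ℝ (Fin n)) :
    charFun (P.map (X t)) ξ = charFun (densityMeasure pH) (Real.exp (-t / 2) • ξ) *
      Complex.exp (-((1 - Real.exp (-t)) * ‖ξ‖ ^ 2 / 2 : ℝ)) := by
  have hfin : IsProbabilityMeasure (densityMeasure pH) := hX.init.isProbabilityMeasure_iff.1 ‹_›
  let a : ℕ → ℝ := fun k => (1 - (t : ℝ) / k / 2) ^ k
  let c : ℕ → ℕ → ℝ := fun k j => (1 - (t : ℝ) / k / 2) ^ (k - 1 - j)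
  let τ : ℕ → ℕ → ℝ≥0 := fun k j => j * (t / k)
  have hτ : ∀ k, Monotone (τ k) := fun k i j hij =>
    mul_le_mul_left (by exact_mod_cast hij) _
  let S : ℕ → Ω → EuclideanSpace ℝ (Fin n) := fun k ω =>
    ∑ j ∈ Finset.range k, c k j • (W (τ k (j + 1)) ω - W (τ k j) ω)
  have hSm : ∀ k, AEMeasurable (S k) P := fun k => Finset.aemeasurable_fun_sum _ fun j _ =>
    ((hX.brownian.aemeasurable (τ k (j + 1))).sub
      (hX.brownian.aemeasurable (τ k j))).const_smul (c k j)
  have hX0m : ∀ k, AEMeasurable (fun ω => a k • X 0 ω) P := fun k =>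
    (hX.aemeasurable 0).const_smul (a k)
  have hind : ∀ k, IndepFun (fun ω => a k • X 0 ω) (S k) P := fun k =>
    hX.indep.comp (φ := fun x => a k • x)
      (ψ := fun w : ℝ≥0 → EuclideanSpace ℝ (Fin n) =>
        ∑ j ∈ Finset.range k, c k j • (w (τ k (j + 1)) - w (τ k j))) (by fun_prop) (by fun_prop)
  have hcf : ∀ k, charFun (P.map fun ω => a k • X 0 ω + S k ω) ξ =
      charFun (densityMeasure pH) (a k • ξ) * Complex.exp (-((∑ j ∈ Finset.range k,
        ((1 - (t : ℝ) / k / 2) ^ (k - 1 - j)) ^ 2 * ((t : ℝ) / k)) * ‖ξ‖ ^ 2 / 2 : ℝ)) := by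
    intro k
    rw [(hind k).charFun_map_fun_add_eq_mul (hX0m k) (hSm k), Pi.mul_apply,
      charFun_map_smul_comp (hX.aemeasurable 0), hX.init.map_eq,
      hX.brownian.charFun_sum_smul_increments (hτ k) (c k) k ξ]
    congr 6
    refine Finset.sum_congr rfl fun j _ => ?_
    simp only [τ, c]
    push_cast
    ring
  have ha : Tendsto a atTop (𝓝 (Real.exp (-t / 2))) := by
    refine (Real.tendsto_one_add_div_pow_exp (-t / 2)).congr fun k => ?_
    simp only [a]
    congr 1
    ring
  -- The same sequence has two limits: one from the explicit formula `hcf`, the other from almost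
  -- sure Euler convergence and dominated convergence.
  have hlim1 : Tendsto (fun k => charFun (P.map fun ω => a k • X 0 ω + S k ω) ξ) atTop
      (𝓝 (charFun (densityMeasure pH) (Real.exp (-t / 2) • ξ) *
        Complex.exp (-((1 - Real.exp (-t)) * ‖ξ‖ ^ 2 / 2 : ℝ)))) := by
    simp_rw [hcf]
    refine Tendsto.mul ((continuous_charFun.tendsto _).comp (ha.smul_const ξ)) ?_
    have hc : Continuous fun r : ℝ => Complex.exp (-(r * ‖ξ‖ ^ 2 / 2 : ℝ)) := by fun_prop
    exact (hc.tendsto _).comp (tendsto_euler_variance t)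
  have hlim2 : Tendsto (fun k => charFun (P.map fun ω => a k • X 0 ω + S k ω) ξ) atTop
      (𝓝 (charFun (P.map (X t)) ξ)) := by
    have e : ∀ Y : Ω → EuclideanSpace ℝ (Fin n), AEMeasurable Y P →
        charFun (P.map Y) ξ = ∫ ω, Complex.exp (inner ℝ (Y ω) ξ * Complex.I) ∂P := fun Y hY => by
      rw [charFun_apply, integral_map hY (by fun_prop)]
    have hY : ∀ k, AEMeasurable (fun ω => a k • X 0 ω + S k ω) P := fun k =>
      (hX0m k).add (hSm k)
    simp_rw [fun k => e _ (hY k), e _ (hX.aemeasurable t)]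
    have hcexp : Continuous fun y : EuclideanSpace ℝ (Fin n) =>
        Complex.exp (inner ℝ y ξ * Complex.I) := by fun_prop
    refine tendsto_integral_of_dominated_convergence (fun _ => 1) (fun k => ?_)
      (integrable_const _) (fun k => .of_forall fun ω => ?_) ?_
    · exact hcexp.comp_aestronglyMeasurable ((hX0m k).add (hSm k)).aestronglyMeasurable
    · rw [Complex.norm_exp_ofReal_mul_I]
    · filter_upwards [hX.continuous_paths, hX.sde] with ω h1 h2
      exact (hcexp.tendsto _).comp (tendsto_euler_scheme (w := fun s => W s ω) h1 h2 t)
  exact tendsto_nhds_unique hlim2 hlim1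

theorem IsVPProcess.hasLaw_densityMeasure_vpDensity (hX : IsVPProcess pH X W P)
    (hpH : Integrable pH) (hpos : ∀ x, 0 < pH x) {t : ℝ≥0} (ht : 0 < t) :
    HasLaw (X t) (densityMeasure (vpDensity pH t)) P := by
  refine ⟨hX.aemeasurable t, ?_⟩
  have : IsFiniteMeasure (densityMeasure (vpDensity pH t)) :=
    isFiniteMeasure_withDensity_ofReal
      (integrable_vpDensity hpH (by exact_mod_cast ht)).hasFiniteIntegral
  refine Measure.ext_of_charFun (funext fun ξ => ?_)
  rw [hX.charFun_map, charFun_densityMeasure_vpDensity hpH hpos (by exact_mod_cast ht)]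

end Brownian

/-! ### The main theorem -/

theorem mainTheorem7 {n : ℕ} (pH V : EuclideanSpace ℝ (Fin n) → ℝ) (Z : ℝ)
    (hpdf : IsProbDensity pH) (hZ : 0 < Z)
    (hpH : ∀ x, pH x = 1 / Z * Real.exp (-V x))
    (hV : ContDiff ℝ 2 V)
    (hconv : ∀ x v : EuclideanSpace ℝ (Fin n), 0 ≤ fderiv ℝ (fderiv ℝ V) x v v) :
    -- `vpDensity pH t` is the marginal density at time `t` of every solution of the VP SDE
    (∀ (Ω : Type*) [MeasurableSpace Ω] (P : Measure Ω) [IsProbabilityMeasure P]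
        (X W : ℝ≥0 → Ω → EuclideanSpace ℝ (Fin n)), IsVPProcess pH X W P →
        ∀ t : ℝ≥0, 0 < t → HasLaw (X t) (densityMeasure (vpDensity pH t)) P) ∧
    -- the score and its derivative exist everywhere, and the derivative is bounded by `L(t)`
    (∀ t : ℝ, 0 < t →
        (∀ x, 0 < vpDensity pH t x) ∧
        Continuous (vpDensity pH t) ∧
        Differentiable ℝ (fun x => Real.log (vpDensity pH t x)) ∧
        Differentiable ℝ (vpScore pH t) ∧
        ∀ x, ‖fderiv ℝ (vpScore pH t) x‖ ≤ 2 / (1 - Real.exp (-t))) ∧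
    -- `1 + L` has a finite integral on every `[δ, T]`
    (∀ δ T : ℝ, 0 < δ → δ < T →
        IntegrableOn (fun t : ℝ => 1 + 2 / (1 - Real.exp (-t))) (Icc δ T) volume) := by
  have hint := hpdf.integrable
  have hpos : ∀ x, 0 < pH x := fun x => by rw [hpH]; positivity
  have hcont : Continuous pH := by
    rw [show pH = _ from funext hpH]
    have := hV.continuous
    fun_prop
  have hlc : ∀ x y, pH x * pH y ≤ pH ((2⁻¹ : ℝ) • (x + y)) ^ 2 := fun x y => by
    rw [hpH, hpH, hpH, mul_mul_mul_comm, mul_pow, ← sq, ← Real.exp_add, ← Real.exp_nat_mul]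
    have := two_mul_apply_midpoint_le hV hconv x y
    refine mul_le_mul_of_nonneg_left (Real.exp_le_exp.2 ?_) (by positivity)
    push_cast
    linarith
  refine ⟨fun Ω _ P _ X W hX t ht => hX.hasLaw_densityMeasure_vpDensity hint hpos ht,
    fun t ht => ⟨vpDensity_pos hint hpos ht,
      continuous_iff_continuousAt.2 fun x => (hasFDerivAt_vpDensity hint ht x).continuousAt,
      fun x => (hasFDerivAt_log_vpDensity hint hpos ht x).differentiableAt,
      differentiable_vpScore hint hpos ht, fun x => ?_⟩, fun δ T hδ _ => ?_⟩
  · refine (norm_fderiv_vpScore_le hint hcont.measurable hpos hlc ht x).trans ?_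
    exact div_le_div_of_nonneg_right (by norm_num) (one_sub_exp_neg_pos ht).le
  · refine ContinuousOn.integrableOn_Icc ?_
    -- The only singularity of `L` is at `t = 0`, which `δ > 0` excludes.
    refine continuousOn_const.add (continuousOn_const.div (by fun_prop) fun t ht => ?_)
    exact (one_sub_exp_neg_pos (hδ.trans_le ht.1)).ne'
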